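/- Let $\alpha\in\mathbb R$ be irrational, and let $\mathbb A_{2\alpha}$ be the noncommutative torus, i.e. the universal unital $C^*$-algebra generated by two unitaries $U,V$ with $UV=e^{4\pi i\alpha}VU$. For $(m,n)\in\mathbb Z^2$ put $W(m,n)=e^{-2\pi i\alpha mn}U^mV^n$, and for finitely supported $f:\mathbb Z^2\to\mathbb C$ put $W(f)=\sum_{a\in\mathbb Z^2}f(a)W(a)$. Let $\mu$ be a Borel probability measure on the unit circle $\mathbb T$, with $\check\mu(m)=\int_{\mathbb T}z^m\,d\mu(z)$, and let $\omega_\mu$ be the unique state of $\mathbb A_{2\alpha}$ such that $$\omega_\mu(W(f))=\sum_{m\in\mathbb Z}\check\mu(m)f(m,0)$$ for all finitely supported $f$. Let $R$ be the rotation of $\mathbb T$ by the angle $2\pi\alpha$, and suppose that $\mu\circ R^{2n}$ (the measure $E\mapsto\mu(R^{2n}E)$) is absolutely continuous with respect to $\mu$ for every $n\in\mathbb Z$. Then the support $s(\omega_\mu)$ of $\omega_\mu$ in the bidual $\mathbb A_{2\alpha}^{**}$ (the smallest projection $p\in\mathbb A_{2\alpha}^{**}$ with $\omega_\mu(p)=1$)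 is central: $s(\omega_\mu)\in Z(\mathbb A_{2\alpha}^{**})$. Equivalently, the cyclic vector $\xi_{\omega_\mu}$ of the GNS representation $\pi_{\omega_\mu}$ is separating for the von Neumann algebra $\pi_{\omega_\mu}(\mathbb A_{2\alpha})''$. In particular, both of these properties hold. -/

import Mathlib

open scoped ENNReal ComplexOrder InnerProductSpace

noncomputable section

/-! ### The circle and its rotations -/

instance Circle.instMeasurableSpaceBorel : MeasurableSpace Circle := borel Circle

instance Circle.instBorelSpaceBorel : BorelSpace Circle := ⟨rfl⟩

/-- The rotation `R` of the unit circle by the angle `2πα`, as a homeomorphism; `R ^ n` is its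
`n`-fold iterate, for every integer `n`. -/
def circleRotation (α : ℝ) : Circle ≃ₜ Circle :=
  Homeomorph.mulLeft (Circle.exp (2 * Real.pi * α))

/-! ### The noncommutative torus -/

/-- Two unitaries `u, v` of a nonzero unital C⋆-algebra with `u v = e^{4πiα} v u`. -/
structure RotationPair (α : ℝ) : Type 1 where
  carrier : Type
  [cstar : CStarAlgebra carrier]
  [nontriv : Nontrivial carrier]
  u : unitary carrier
  v : unitary carrier
  comm : (u * v : carrier) =
    Complex.exp (4 * Real.pi * Complex.I * α) • ((v : carrier) * (u : carrier))

namespace RotationPair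

instance (α : ℝ) (i : RotationPair α) : CStarAlgebra i.carrier := i.cstar

instance (α : ℝ) (i : RotationPair α) : Nontrivial i.carrier := i.nontriv

end RotationPair

/-- The C⋆-algebra of all bounded families `(b_i)`, with `b_i` in the C⋆-algebra of the pair `i`,
where `i` runs over all pairs of unitaries satisfying the commutation relation. -/
abbrev RotationProduct (α : ℝ) : Type 1 := lp (fun i : RotationPair α => i.carrier) ∞

instance (α : ℝ) : CStarAlgebra (RotationProduct α) where

namespace NCTorus

/-- A family of unitaries, as an element of the product. -/
def prodElem (α : ℝ) (w : ∀ i : RotationPair α, unitary i.carrier) : RotationProduct α :=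
  ⟨fun i => (w i : i.carrier), memℓp_infty ⟨1, by
    rintro _ ⟨i, rfl⟩
    exact (CStarRing.norm_coe_unitary (w i)).le⟩⟩

theorem prodElem_mem (α : ℝ) (w : ∀ i : RotationPair α, unitary i.carrier) :
    prodElem α w ∈ unitary (RotationProduct α) := by
  rw [Unitary.mem_iff]
  constructor <;>
  · apply lp.ext
    funext i
    simp [lp.infty_coeFn_mul, prodElem]

/-- The closed unital star subalgebra generated by the two universal unitaries. -/
def subalgebra (α : ℝ) : StarSubalgebra ℂ (RotationProduct α) :=
  (StarAlgebra.adjoin ℂ {prodElem α (fun i => i.u), prodElem α (fun i => i.v)}).topologicalClosure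

end NCTorus

/-- The noncommutative torus `𝔸_{2α}`: the universal unital C⋆-algebra generated by two unitaries
`U, V` with `U V = e^{4πiα} V U`. It is realised as the C⋆-subalgebra generated by the pair
`((u_i), (v_i))` inside the bounded product over all such pairs `(u_i, v_i)` of unitaries in
C⋆-algebras; see `NCTorus.comm`, `NCTorus.closure_adjoin` and `NCTorus.existsUnique_lift`. Any C⋆-algebra
generated by two elements has at most continuum many elements, hence a copy in `Type`, so it is
enough to let the pairs live in C⋆-algebras in `Type`. -/
def NCTorus (α : ℝ) : Type 1 := NCTorus.subalgebra α

namespace NCTorus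

variable (α : ℝ)

instance : CStarAlgebra (NCTorus α) :=
  haveI : IsClosed (subalgebra α : Set (RotationProduct α)) :=
    StarSubalgebra.isClosed_topologicalClosure _
  inferInstanceAs (CStarAlgebra (subalgebra α))

/-- The canonical order of the C⋆-algebra `𝔸_{2α}`, whose positive elements are the `a⋆ a`. -/
instance : PartialOrder (NCTorus α) := CStarAlgebra.spectralOrder (NCTorus α)

instance : StarOrderedRing (NCTorus α) := CStarAlgebra.spectralOrderedRing (NCTorus α)

/-- The inclusion of `𝔸_{2α}` in the product. -/
def incl : NCTorus α →⋆ₐ[ℂ] RotationProduct α := (subalgebra α).subtype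

/-- The canonical unital star homomorphism of `𝔸_{2α}` sending `U, V` to a given pair. -/
def eval (i : RotationPair α) : NCTorus α →⋆ₐ[ℂ] i.carrier where
  toFun a := incl α a i
  map_one' := by simp [lp.infty_coeFn_one]
  map_mul' a b := by simp [lp.infty_coeFn_mul]
  map_zero' := by simp
  map_add' a b := by simp
  commutes' r := by
    rw [Algebra.algebraMap_eq_smul_one, Algebra.algebraMap_eq_smul_one, map_smul, map_one,
      lp.coeFn_smul, Pi.smul_apply, lp.infty_coeFn_one, Pi.one_apply]
  map_star' a := by rw [map_star, lp.star_apply]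

/-- The unitary generator `U` of `𝔸_{2α}`. -/
def U : unitary (NCTorus α) :=
  ⟨⟨prodElem α (fun i => i.u), StarSubalgebra.le_topologicalClosure _
      (StarAlgebra.subset_adjoin ℂ _ (by simp))⟩, by
    have h := Unitary.mem_iff.mp (prodElem_mem α (fun i => i.u))
    exact Unitary.mem_iff.mpr ⟨Subtype.ext h.1, Subtype.ext h.2⟩⟩

/-- The unitary generator `V` of `𝔸_{2α}`. -/
def V : unitary (NCTorus α) :=
  ⟨⟨prodElem α (fun i => i.v), StarSubalgebra.le_topologicalClosure _
      (StarAlgebra.subset_adjoin ℂ _ (by simp))⟩, by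
    have h := Unitary.mem_iff.mp (prodElem_mem α (fun i => i.v))
    exact Unitary.mem_iff.mpr ⟨Subtype.ext h.1, Subtype.ext h.2⟩⟩

@[simp] theorem eval_U (i : RotationPair α) : eval α i (U α) = i.u := rfl

@[simp] theorem eval_V (i : RotationPair α) : eval α i (V α) = i.v := rfl

variable {α}

theorem ext_eval {a b : NCTorus α} (h : ∀ i, eval α i a = eval α i b) : a = b :=
  Subtype.ext (lp.ext (funext h))

variable (α)

theorem comm : (U α * V α : NCTorus α) =
    Complex.exp (4 * Real.pi * Complex.I * α) • ((V α : NCTorus α) * (U α : NCTorus α)) := by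
  refine ext_eval fun i => ?_
  simpa using i.comm

theorem closure_adjoin :
    (StarAlgebra.adjoin ℂ {(U α : NCTorus α), (V α : NCTorus α)}).topologicalClosure = ⊤ := by
  rw [eq_top_iff]
  intro a _
  have hind : Topology.IsInducing (incl α) := Topology.IsInducing.subtypeVal
  have hmap := StarAlgHom.map_adjoin (incl α) {(U α : NCTorus α), (V α : NCTorus α)}
  rw [Set.image_pair] at hmap
  have h1 : incl α a ∈ closure ((StarAlgebra.adjoin ℂ
      {incl α (U α), incl α (V α)} : StarSubalgebra ℂ (RotationProduct α)) :
        Set (RotationProduct α)) := a.2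
  rw [← hmap, StarSubalgebra.coe_map] at h1
  change a ∈ closure _
  rw [hind.closure_eq_preimage_closure_image]
  exact h1

open scoped CStarAlgebra in
/-- The universal property of `𝔸_{2α}`. -/
theorem existsUnique_lift (B : Type) [CStarAlgebra B] (u v : unitary B)
    (h : (u * v : B) = Complex.exp (4 * Real.pi * Complex.I * α) • ((v : B) * (u : B))) :
    ∃! φ : NCTorus α →⋆ₐ[ℂ] B, φ (U α) = u ∧ φ (V α) = v := by
  refine existsUnique_of_exists_of_unique ?_ ?_
  · rcases subsingleton_or_nontrivial B with hB | hB
    · exact ⟨{ toFun := fun _ => 0, map_one' := Subsingleton.elim _ _,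
               map_mul' := fun _ _ => Subsingleton.elim _ _, map_zero' := rfl,
               map_add' := fun _ _ => Subsingleton.elim _ _,
               commutes' := fun _ => Subsingleton.elim _ _,
               map_star' := fun _ => Subsingleton.elim _ _ },
        Subsingleton.elim _ _, Subsingleton.elim _ _⟩
    · exact ⟨eval α ⟨B, u, v, h⟩, rfl, rfl⟩
  · rintro φ ψ ⟨h1, h2⟩ ⟨h3, h4⟩
    have hle : StarAlgebra.adjoin ℂ {(U α : NCTorus α), (V α : NCTorus α)} ≤
        StarAlgHom.equalizer φ ψ := by
      rw [StarAlgebra.adjoin_le_iff]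
      rintro x (rfl | rfl)
      · exact h1.trans h3.symm
      · exact h2.trans h4.symm
    have hcl := StarSubalgebra.topologicalClosure_minimal hle
      (isClosed_eq (map_continuous φ) (map_continuous ψ))
    rw [closure_adjoin] at hcl
    exact StarAlgHom.ext fun a => hcl (show a ∈ (⊤ : StarSubalgebra ℂ (NCTorus α)) from trivial)

/-! ### Weyl elements -/

/-- The Weyl unitary `W(m, n) = e^{-2πiα mn} U^m V^n`. -/
def weyl (a : ℤ × ℤ) : NCTorus α :=
  Complex.exp (-(2 * Real.pi * Complex.I * α * a.1 * a.2)) •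
    ((U α ^ a.1 * V α ^ a.2 : unitary (NCTorus α)) : NCTorus α)

/-- `W(f) = ∑_a f(a) W(a)` for a finitely supported `f`. -/
def weylSum (f : ℤ × ℤ →₀ ℂ) : NCTorus α := f.sum fun a c => c • weyl α a

theorem V_zpow_mul_U_zpow (m n : ℤ) : ∃ c : ℂ,
    ((V α ^ n * U α ^ m : unitary (NCTorus α)) : NCTorus α) =
      c • ((U α ^ m * V α ^ n : unitary (NCTorus α)) : NCTorus α) := by
  let q : ℂ := Complex.exp (4 * Real.pi * Complex.I * α)
  have hq : star q * q = 1 := by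
    have : ‖q‖ = 1 := by
      rw [show q = Complex.exp (((4 * Real.pi * α : ℝ) : ℂ) * Complex.I) by
        simp only [q]; congr 1; push_cast; ring]
      exact Complex.norm_exp_ofReal_mul_I _
    rw [RCLike.star_def, Complex.conj_mul', this]; simp
  let r : unitary ℂ := ⟨q, Unitary.mem_iff.mpr ⟨hq, by rw [mul_comm, hq]⟩⟩
  let am : ℂ →⋆* NCTorus α :=
    { toFun := algebraMap ℂ (NCTorus α), map_one' := map_one _, map_mul' := map_mul _,
      map_star' := fun z => algebraMap_star_comm z }
  let s : unitary (NCTorus α) := Unitary.map am r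
  have hs : ∀ (k : ℤ) (x : unitary (NCTorus α)), Commute (s ^ k) x := fun k x => by
    refine Commute.zpow_left ?_ k
    exact Subtype.ext (Algebra.commutes q (x : NCTorus α))
  have h0 : U α * V α = s * (V α * U α) := by
    apply Subtype.ext
    change (U α * V α : NCTorus α) = algebraMap ℂ _ q * ((V α : NCTorus α) * (U α : NCTorus α))
    rw [comm, Algebra.smul_def]
  have h1 : SemiconjBy (V α) (U α) (s ^ (-1 : ℤ) * U α) := by
    change V α * U α = s ^ (-1 : ℤ) * U α * V α
    rw [mul_assoc, h0, zpow_neg_one, inv_mul_cancel_left]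
  have h2 : SemiconjBy (U α ^ m) ((s ^ (-1 : ℤ)) ^ m * V α) (V α) := by
    have := h1.zpow_right m
    rw [(hs (-1) (U α)).mul_zpow] at this
    change U α ^ m * _ = _ * _
    rw [this.eq, ← mul_assoc, ← zpow_mul, ← (hs _ (U α ^ m)).eq]
  have h3 := h2.zpow_right n
  rw [← zpow_mul, (hs _ (V α)).mul_zpow, ← zpow_mul] at h3
  refine ⟨((r ^ (-1 * m * n) : unitary ℂ) : ℂ), ?_⟩
  rw [← h3.eq, ← mul_assoc, ← (hs _ (U α ^ m)).eq, mul_assoc, Algebra.smul_def, Submonoid.coe_mul]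
  congr 1
  rw [show s ^ (-1 * m * n) = Unitary.map am (r ^ (-1 * m * n)) from (map_zpow _ _ _).symm]
  rfl

/-- The elements `W(f)`, `f` finitely supported, are dense. -/
theorem closure_span_weyl :
    closure (Submodule.span ℂ (Set.range (weyl α)) : Set (NCTorus α)) = Set.univ := by
  have key : ∀ m n : ℤ, ((U α ^ m * V α ^ n : unitary (NCTorus α)) : NCTorus α) ∈
      Submodule.span ℂ (Set.range (weyl α)) := by
    intro m n
    have : weyl α (m, n) ∈ Submodule.span ℂ (Set.range (weyl α)) :=
      Submodule.subset_span ⟨_, rfl⟩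
    exact (Submodule.smul_mem_iff _ (Complex.exp_ne_zero _)).mp this
  have key2 : ∀ m n : ℤ, ((V α ^ n * U α ^ m : unitary (NCTorus α)) : NCTorus α) ∈
      Submodule.span ℂ (Set.range (weyl α)) := by
    intro m n
    obtain ⟨c, hc⟩ := V_zpow_mul_U_zpow α m n
    rw [hc]
    exact Submodule.smul_mem _ _ (key m n)
  have hmul : ∀ x ∈ Submodule.span ℂ (Set.range (weyl α)),
      ∀ y ∈ Submodule.span ℂ (Set.range (weyl α)),
        x * y ∈ Submodule.span ℂ (Set.range (weyl α)) := by
    intro x hx y hy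
    induction hx, hy using Submodule.span_induction₂ with
    | mem_mem x y hx hy =>
      obtain ⟨⟨m, n⟩, rfl⟩ := hx
      obtain ⟨⟨m', n'⟩, rfl⟩ := hy
      simp only [weyl, smul_mul_smul_comm]
      refine Submodule.smul_mem _ _ ?_
      obtain ⟨c, hc⟩ := V_zpow_mul_U_zpow α m' n
      have : ((U α ^ m * V α ^ n : unitary (NCTorus α)) : NCTorus α) *
          ((U α ^ m' * V α ^ n' : unitary (NCTorus α)) : NCTorus α) =
          c • ((U α ^ (m + m') * V α ^ (n + n') : unitary (NCTorus α)) : NCTorus α) := by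
        rw [zpow_add, zpow_add, ← Submonoid.coe_mul,
          show U α ^ m * V α ^ n * (U α ^ m' * V α ^ n') =
            U α ^ m * (V α ^ n * U α ^ m') * V α ^ n' by simp only [mul_assoc],
          Submonoid.coe_mul, Submonoid.coe_mul, hc]
        simp only [Submonoid.coe_mul, mul_smul_comm, smul_mul_assoc, mul_assoc]
      rw [this]
      exact Submodule.smul_mem _ _ (key _ _)
    | zero_left => simp
    | zero_right => simp
    | add_left x y z _ _ _ h1 h2 => rw [add_mul]; exact add_mem h1 h2
    | add_right x y z _ _ _ h1 h2 => rw [mul_add]; exact add_mem h1 h2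
    | smul_left r x y _ _ h => rw [smul_mul_assoc]; exact Submodule.smul_mem _ _ h
    | smul_right r x y _ _ h => rw [mul_smul_comm]; exact Submodule.smul_mem _ _ h
  have hstar : ∀ x ∈ Submodule.span ℂ (Set.range (weyl α)),
      star x ∈ Submodule.span ℂ (Set.range (weyl α)) := by
    intro x hx
    induction hx using Submodule.span_induction with
    | mem x hx =>
      obtain ⟨⟨m, n⟩, rfl⟩ := hx
      simp only [weyl, star_smul]
      refine Submodule.smul_mem _ _ ?_
      rw [← Unitary.coe_star, Unitary.star_eq_inv, mul_inv_rev, ← zpow_neg, ← zpow_neg]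
      exact key2 _ _
    | zero => simp
    | add x y _ _ h1 h2 => rw [star_add]; exact add_mem h1 h2
    | smul r x _ h => rw [star_smul]; exact Submodule.smul_mem _ _ h
  have h1 : ((1 : unitary (NCTorus α)) : NCTorus α) ∈
      Submodule.span ℂ (Set.range (weyl α)) := by simpa using key 0 0
  have hle : ∀ a ∈ StarAlgebra.adjoin ℂ {(U α : NCTorus α), (V α : NCTorus α)},
      a ∈ Submodule.span ℂ (Set.range (weyl α)) := by
    intro a ha
    induction ha using StarAlgebra.adjoin_induction with
    | mem x hx =>
      rcases hx with rfl | rfl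
      · simpa using key 1 0
      · simpa using key 0 1
    | algebraMap r =>
      rw [Algebra.algebraMap_eq_smul_one]
      exact Submodule.smul_mem _ _ h1
    | add x y _ _ h1 h2 => exact add_mem h1 h2
    | mul x y _ _ h1 h2 => exact hmul _ h1 _ h2
    | star x _ h => exact hstar _ h
  refine Set.eq_univ_of_univ_subset ?_
  have := closure_adjoin α
  intro a _
  have ha : a ∈ (StarAlgebra.adjoin ℂ
      {(U α : NCTorus α), (V α : NCTorus α)}).topologicalClosure := by
    rw [this]; trivial
  exact closure_mono hle ha

end NCTorus

/-! ### The states `ω_μ` -/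

/-- The Fourier anti-transform `μ̌(m) = ∫ z^m dμ(z)` of a measure on the circle. -/
def fourierAnti (μ : MeasureTheory.Measure Circle) (m : ℤ) : ℂ :=
  ∫ z : Circle, (z : ℂ) ^ m ∂μ

namespace NCTorus

/-- The Hilbert space `ℓ²(ℤ)`. -/
abbrev Ell2 : Type := lp (fun _ : ℤ => ℂ) 2

theorem memℓp_twist (c : ℤ → Circle) (e : ℤ ≃ ℤ) (g : Ell2) :
    Memℓp (fun n => (c n : ℂ) * g (e n)) 2 := by
  rw [memℓp_gen_iff (by simp)]
  have h := (memℓp_gen_iff (by simp)).mp (lp.memℓp g)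
  refine (e.summable_iff.mpr h).congr fun n => ?_
  rw [norm_mul, Circle.norm_coe, one_mul, Function.comp_apply]

/-- The isometry `g ↦ (n ↦ c_n g(e n))` of `ℓ²(ℤ)`. -/
def twistIsom (c : ℤ → Circle) (e : ℤ ≃ ℤ) : Ell2 →ₗᵢ[ℂ] Ell2 where
  toFun g := ⟨fun n => (c n : ℂ) * g (e n), memℓp_twist c e g⟩
  map_add' g h := by
    apply lp.ext; funext n
    exact mul_add _ _ _
  map_smul' r g := by
    apply lp.ext; funext n
    exact mul_left_comm _ _ _
  norm_map' g := by
    have h2 : 0 < (2 : ℝ≥0∞).toReal := by simp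
    have h3 : ∀ h : Ell2, ‖h‖ ^ (2 : ℝ≥0∞).toReal = ∑' n, ‖h n‖ ^ (2 : ℝ≥0∞).toReal :=
      fun h => lp.norm_rpow_eq_tsum h2 h
    refine (Real.rpow_left_inj (norm_nonneg _) (norm_nonneg _) h2.ne').mp ?_
    rw [h3 g]
    refine (h3 _).trans ?_
    rw [← e.tsum_eq (fun n => ‖g n‖ ^ (2 : ℝ≥0∞).toReal)]
    refine tsum_congr fun n => ?_
    change ‖(c n : ℂ) * g (e n)‖ ^ _ = _
    rw [norm_mul, Circle.norm_coe, one_mul]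

theorem twistIsom_apply (c : ℤ → Circle) (e : ℤ ≃ ℤ) (g : Ell2) (n : ℤ) :
    twistIsom c e g n = (c n : ℂ) * g (e n) := rfl

/-- The unitary operator `g ↦ (n ↦ c_n g(e n))` of `ℓ²(ℤ)`. -/
def twist (c : ℤ → Circle) (e : ℤ ≃ ℤ) : unitary (Ell2 →L[ℂ] Ell2) :=
  Unitary.linearIsometryEquiv.symm
    (LinearIsometryEquiv.ofSurjective (twistIsom c e) fun g =>
      ⟨twistIsom (fun n => (c (e.symm n))⁻¹) e.symm g, by
        apply lp.ext; funext n
        rw [twistIsom_apply, twistIsom_apply]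
        simp⟩)

theorem twist_apply (c : ℤ → Circle) (e : ℤ ≃ ℤ) (g : Ell2) (n : ℤ) :
    (twist c e : Ell2 →L[ℂ] Ell2) g n = (c n : ℂ) * g (e n) := rfl

theorem twist_mul (c d : ℤ → Circle) (e f : ℤ ≃ ℤ) :
    twist c e * twist d f = twist (fun n => c n * d (e n)) (e.trans f) := by
  apply Subtype.ext
  ext g n
  rw [Submonoid.coe_mul, mul_apply_eq_comp, twist_apply, twist_apply, twist_apply]
  simp [mul_assoc]

theorem twist_one : twist 1 (Equiv.refl ℤ) = 1 := by
  apply Subtype.ext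
  ext g n
  rw [twist_apply]
  simp

/-- The diagonal unitaries. -/
def diagHom : (ℤ → Circle) →* unitary (Ell2 →L[ℂ] Ell2) where
  toFun c := twist c (Equiv.refl ℤ)
  map_one' := twist_one
  map_mul' c d := by rw [twist_mul]; rfl

/-- The shifts. -/
def shiftHom : Multiplicative ℤ →* unitary (Ell2 →L[ℂ] Ell2) where
  toFun k := twist 1 (Equiv.subRight k.toAdd)
  map_one' := by
    rw [← twist_one]; congr 1; ext n; simp
  map_mul' k l := by
    rw [twist_mul]; congr 1
    · funext n; simp
    · ext n; simp [sub_sub]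

/-- For `z` in the circle, the pair `(U g)(n) = e^{4πiαn} z g(n)`, `(V g)(n) = g(n - 1)`. -/
def fiberPair (α : ℝ) (z : Circle) : RotationPair α where
  carrier := Ell2 →L[ℂ] Ell2
  cstar := inferInstance
  nontriv := ⟨0, 1, fun h => by
    have := congrArg (fun T : Ell2 →L[ℂ] Ell2 => T (lp.single 2 0 1) 0) h
    simp at this⟩
  u := diagHom fun n => Circle.exp (4 * Real.pi * α * n) * z
  v := shiftHom (Multiplicative.ofAdd 1)
  comm := by
    ext g n
    simp only [diagHom, shiftHom, MonoidHom.coe_mk, OneHom.coe_mk, mul_apply_eq_comp,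
      FunLike.coe_smul, Pi.smul_apply, lp.coeFn_smul, twist_apply, smul_eq_mul,
      Circle.coe_mul, Circle.coe_exp, Equiv.refl_apply, Equiv.subRight_apply, toAdd_ofAdd,
      Pi.one_apply, Circle.coe_one, one_mul]
    rw [← mul_assoc, ← mul_assoc, ← Complex.exp_add]
    congr 3
    push_cast
    ring

variable (α : ℝ)

/-- The canonical homomorphism attached to a pair, as a homomorphism of star monoids. -/
def evalMon (i : RotationPair α) : NCTorus α →⋆* i.carrier where
  toFun := eval α i
  map_one' := map_one _
  map_mul' := map_mul _
  map_star' := map_star _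

/-- The vector functional `a ↦ ⟨δ₀, π_z(a) δ₀⟩`. -/
def fiberState (z : Circle) (a : NCTorus α) : ℂ :=
  inner ℂ (lp.single 2 0 1 : Ell2)
    ((show Ell2 →L[ℂ] Ell2 from eval α (fiberPair α z) a) (lp.single 2 0 1))

theorem fiberState_eq (z : Circle) (a : NCTorus α) :
    fiberState α z a =
      (show Ell2 →L[ℂ] Ell2 from eval α (fiberPair α z) a) (lp.single 2 0 1) 0 := by
  rw [fiberState, lp.inner_single_left]
  simp

theorem fiberState_weyl (z : Circle) (a : ℤ × ℤ) :
    fiberState α z (weyl α a) = if a.2 = 0 then (z : ℂ) ^ a.1 else 0 := by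
  obtain ⟨m, n⟩ := a
  have hU : Unitary.map (evalMon α (fiberPair α z)) (U α) =
    (fiberPair α z).u := rfl
  have hV : Unitary.map (evalMon α (fiberPair α z)) (V α) =
    (fiberPair α z).v := rfl
  have h : eval α (fiberPair α z) ((U α ^ m * V α ^ n : unitary (NCTorus α)) : NCTorus α) =
      ((diagHom (fun n => Circle.exp (4 * Real.pi * α * n) * z) ^ m *
        shiftHom (Multiplicative.ofAdd 1) ^ n : unitary (Ell2 →L[ℂ] Ell2)) :
          Ell2 →L[ℂ] Ell2) := by
    change ((Unitary.map (evalMon α (fiberPair α z))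
      (U α ^ m * V α ^ n) : unitary (fiberPair α z).carrier) : (fiberPair α z).carrier) = _
    rw [map_mul, map_zpow, map_zpow, hU, hV]
    rfl
  rw [fiberState_eq, weyl, map_smul, h, ← map_zpow, ← map_zpow, ← ofAdd_zsmul]
  change Complex.exp _ * ((_ : Ell2 →L[ℂ] Ell2) _ : Ell2) 0 = _
  rw [Submonoid.coe_mul, mul_apply_eq_comp]
  simp only [diagHom, shiftHom, MonoidHom.coe_mk, OneHom.coe_mk, twist_apply]
  by_cases hn : n = 0
  · subst hn; simp
  · simp [hn]

theorem norm_fiberState_le (z : Circle) (a : NCTorus α) : ‖fiberState α z a‖ ≤ ‖a‖ := by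
  have h1 : ‖(lp.single 2 0 1 : Ell2)‖ = 1 := by
    rw [lp.norm_single (by simp)]; simp
  have h2 : ‖eval α (fiberPair α z) a‖ ≤ ‖a‖ := NonUnitalStarAlgHom.norm_apply_le _ _
  refine (norm_inner_le_norm _ _).trans ?_
  rw [h1, one_mul]
  refine (ContinuousLinearMap.le_opNorm _ _).trans ?_
  rw [h1, mul_one]
  exact h2

theorem fiberState_add (z : Circle) (a b : NCTorus α) :
    fiberState α z (a + b) = fiberState α z a + fiberState α z b := by
  simp only [fiberState_eq, map_add]; rfl

theorem fiberState_smul (z : Circle) (r : ℂ) (a : NCTorus α) :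
    fiberState α z (r • a) = r * fiberState α z a := by
  simp only [fiberState_eq, map_smul]; rfl

theorem fiberState_nonneg (z : Circle) (a : NCTorus α) (ha : 0 ≤ a) : 0 ≤ fiberState α z a := by
  obtain ⟨b, rfl⟩ := CStarAlgebra.nonneg_iff_eq_star_mul_self.mp ha
  have : fiberState α z (star b * b) =
      inner ℂ ((show Ell2 →L[ℂ] Ell2 from eval α (fiberPair α z) b) (lp.single 2 0 1))
        ((show Ell2 →L[ℂ] Ell2 from eval α (fiberPair α z) b) (lp.single 2 0 1)) := by
    rw [fiberState, map_mul, map_star]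
    exact ContinuousLinearMap.adjoint_inner_right
      (show Ell2 →L[ℂ] Ell2 from eval α (fiberPair α z) b) _ _
  rw [this, inner_self_eq_norm_sq_to_K]
  positivity

theorem continuous_fiberState (a : NCTorus α) : Continuous fun z => fiberState α z a := by
  have ha : a ∈ closure (Submodule.span ℂ (Set.range (weyl α)) : Set (NCTorus α)) := by
    rw [closure_span_weyl]; trivial
  have hspan : ∀ x ∈ Submodule.span ℂ (Set.range (weyl α)),
      Continuous fun z => fiberState α z x := by
    intro x hx
    induction hx using Submodule.span_induction with
    | mem x hx =>
      obtain ⟨⟨m, n⟩, rfl⟩ := hx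
      simp only [fiberState_weyl]
      by_cases hn : n = 0
      · simp only [hn, if_true]
        have h : Continuous fun z : Circle => ((z ^ m : Circle) : ℂ) :=
          (continuous_induced_dom : Continuous fun z : Circle => (z : ℂ)).comp (continuous_zpow m)
        simpa only [Circle.coe_zpow] using h
      · simp only [hn, if_false]; exact continuous_const
    | zero =>
      have : ∀ z, fiberState α z 0 = 0 := fun z => by
        rw [← zero_smul ℂ (0 : NCTorus α), fiberState_smul, zero_mul]
      simpa only [this] using continuous_const
    | add x y _ _ h1 h2 => simp only [fiberState_add]; exact h1.add h2
    | smul r x _ h => simp only [fiberState_smul]; exact continuous_const.mul h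
  obtain ⟨x, hx, hlim⟩ := mem_closure_iff_seq_limit.mp ha
  have hunif : TendstoUniformly (fun (k : ℕ) z => fiberState α z (x k))
      (fun z => fiberState α z a) Filter.atTop := by
    rw [Metric.tendstoUniformly_iff]
    intro ε hε
    filter_upwards [Metric.tendsto_atTop'.mp hlim ε hε |>.elim fun N hN =>
      Filter.eventually_gt_atTop N |>.mono hN] with k hk z
    rw [dist_eq_norm]
    have : fiberState α z a - fiberState α z (x k) = fiberState α z (a - x k) := by
      rw [sub_eq_add_neg a, fiberState_add, ← neg_one_smul ℂ (x k), fiberState_smul]; ring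
    rw [this]
    refine (norm_fiberState_le α z _).trans_lt ?_
    rwa [← dist_eq_norm, dist_comm]
  exact hunif.continuous (Filter.Eventually.of_forall fun k => hspan _ (hx k)).frequently

variable (μ : MeasureTheory.Measure Circle)

open scoped CStarAlgebra in
/-- The formula `ω(W(f)) = ∑_m μ̌(m) f(m, 0)` defines a unique positive functional. -/
theorem existsUnique_state [MeasureTheory.IsProbabilityMeasure μ] :
    ∃! ω : NCTorus α →ₚ[ℂ] ℂ, ∀ f : ℤ × ℤ →₀ ℂ,
      ω (weylSum α f) = ∑ᶠ m : ℤ, fourierAnti μ m * f (m, 0) := by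
  refine existsUnique_of_exists_of_unique ?_ ?_
  · have hint : ∀ a : NCTorus α, MeasureTheory.Integrable (fun z => fiberState α z a) μ := fun a =>
      (continuous_fiberState α a).integrable_of_hasCompactSupport
        (HasCompactSupport.of_compactSpace _)
    let ω : NCTorus α →ₚ[ℂ] ℂ := PositiveLinearMap.mk₀
      { toFun := fun a => ∫ z, fiberState α z a ∂μ
        map_add' := fun a b => by
          simp only [fiberState_add]
          exact MeasureTheory.integral_add (hint a) (hint b)
        map_smul' := fun r a => by
          simp only [fiberState_smul]
          exact MeasureTheory.integral_const_mul _ _ }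
      (fun a ha => MeasureTheory.integral_nonneg fun z => fiberState_nonneg α z a ha)
    have hω : ∀ a, ω (weyl α a) = if a.2 = 0 then fourierAnti μ a.1 else 0 := by
      intro a
      change ∫ z, fiberState α z (weyl α a) ∂μ = _
      simp only [fiberState_weyl]
      split_ifs
      · rfl
      · simp
    refine ⟨ω, fun f => ?_⟩
    induction f using Finsupp.induction_linear with
    | zero => simp [weylSum]
    | add f g hf hg =>
      have : weylSum α (f + g) = weylSum α f + weylSum α g :=
        Finsupp.sum_add_index' (by simp) (by simp [add_smul])
      rw [this, map_add, hf, hg, ← finsum_add_distrib]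
      · exact finsum_congr fun m => by simp [mul_add]
      · refine Set.Finite.subset (s := (f.support.image Prod.fst : Finset ℤ)) (Finset.finite_toSet _) ?_
        intro m hm
        have := right_ne_zero_of_mul hm
        simp only [Finset.coe_image, Set.mem_image, Finset.mem_coe, Finsupp.mem_support_iff]
        exact ⟨(m, 0), this, rfl⟩
      · refine Set.Finite.subset (s := (g.support.image Prod.fst : Finset ℤ)) (Finset.finite_toSet _) ?_
        intro m hm
        have := right_ne_zero_of_mul hm
        simp only [Finset.coe_image, Set.mem_image, Finset.mem_coe, Finsupp.mem_support_iff]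
        exact ⟨(m, 0), this, rfl⟩
    | single a c =>
      obtain ⟨m, n⟩ := a
      have : weylSum α (Finsupp.single (m, n) c) = c • weyl α (m, n) :=
        Finsupp.sum_single_index (by simp)
      rw [this, map_smul, hω, finsum_eq_single _ m]
      · by_cases hn : n = 0
        · subst hn; simp [mul_comm]
        · simp [hn]
      · intro k hk
        simp [hk.symm]
  · intro ω ω' h h'
    have hw : ∀ a, ω (weyl α a) = ω' (weyl α a) := by
      intro a
      have : weylSum α (Finsupp.single a 1) = weyl α a := by
        simp [weylSum]
      rw [← this, h, h']
    ext a
    have ha : a ∈ closure (Submodule.span ℂ (Set.range (weyl α)) : Set (NCTorus α)) := by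
      rw [closure_span_weyl]; trivial
    refine closure_minimal (t := {a | ω a = ω' a}) ?_
      (isClosed_eq (map_continuous ω) (map_continuous ω')) ha
    intro x hx
    induction hx using Submodule.span_induction with
    | mem x hx => obtain ⟨a, rfl⟩ := hx; exact hw a
    | zero => simp
    | add x y _ _ h1 h2 => simp only [Set.mem_ofPred_eq, map_add] at *; rw [h1, h2]
    | smul r x _ h => simp only [Set.mem_ofPred_eq, map_smul] at *; rw [h]

/-- The state `ω_μ` of `𝔸_{2α}`: the positive functional with
`ω_μ(W(f)) = ∑_m μ̌(m) f(m, 0)` for all finitely supported `f`. -/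
def state [MeasureTheory.IsProbabilityMeasure μ] : NCTorus α →ₚ[ℂ] ℂ :=
  (existsUnique_state α μ).choose

theorem state_weylSum [MeasureTheory.IsProbabilityMeasure μ] (f : ℤ × ℤ →₀ ℂ) :
    state α μ (weylSum α f) = ∑ᶠ m : ℤ, fourierAnti μ m * f (m, 0) :=
  (existsUnique_state α μ).choose_spec.1 f

end NCTorus

/-! ### The bidual of a C⋆-algebra -/

section Bidual

variable (A : Type*) [CStarAlgebra A]

/-- The bidual `A⋆⋆`. -/
abbrev Bidual : Type _ := StrongDual ℂ (StrongDual ℂ A)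

variable {A}

/-- The adjoint functional `φ⋆(a) = conj φ(a⋆)`. -/
def dualStar (φ : StrongDual ℂ A) : StrongDual ℂ A :=
  ((starL ℂ : ℂ ≃L⋆[ℂ] ℂ) : ℂ →L⋆[ℂ] ℂ).comp (φ.comp ((starL ℂ : A ≃L⋆[ℂ] A) : A →L⋆[ℂ] A))

@[simp] theorem dualStar_apply (φ : StrongDual ℂ A) (a : A) :
    dualStar φ a = star (φ (star a)) := rfl

theorem norm_dualStar_le (φ : StrongDual ℂ A) : ‖dualStar φ‖ ≤ ‖φ‖ :=
  ContinuousLinearMap.opNorm_le_bound _ (norm_nonneg _) fun a => by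
    simpa using φ.le_opNorm (star a)

namespace Bidual

/-- `φ ↦ (a ↦ φ · a)`, where `(φ · a)(b) = φ(a b)`. -/
def dualMul : StrongDual ℂ A →L[ℂ] A →L[ℂ] StrongDual ℂ A :=
  ((ContinuousLinearMap.compL ℂ A (A →L[ℂ] A) (StrongDual ℂ A)).flip
    (ContinuousLinearMap.mul ℂ A)).comp (ContinuousLinearMap.compL ℂ A A ℂ)

@[simp] theorem dualMul_apply (φ : StrongDual ℂ A) (a b : A) : dualMul φ a b = φ (a * b) := rfl

/-- The functional `G · φ` given by `(G · φ)(a) = G(φ · a)`. -/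
def act (G : Bidual A) : StrongDual ℂ A →L[ℂ] StrongDual ℂ A :=
  (ContinuousLinearMap.compL ℂ A (StrongDual ℂ A) ℂ G).comp dualMul

@[simp] theorem act_apply (G : Bidual A) (φ : StrongDual ℂ A) (a : A) :
    act G φ a = G (dualMul φ a) := rfl

/-- The (Arens) product of the bidual, `(F G)(φ) = F(G · φ)`. It extends the product of `A`. -/
instance : Mul (Bidual A) := ⟨fun F G => F.comp (act G)⟩

theorem mul_apply (F G : Bidual A) (φ : StrongDual ℂ A) : (F * G) φ = F (act G φ) := rfl

/-- The involution of the bidual, `F⋆(φ) = conj F(φ⋆)`. It extends the involution of `A`. -/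
instance : Star (Bidual A) := ⟨fun F =>
  LinearMap.mkContinuous
    { toFun := fun φ => star (F (dualStar φ))
      map_add' := fun φ ψ => by
        have : dualStar (φ + ψ) = dualStar φ + dualStar ψ := by ext; simp
        rw [this, map_add, star_add]
      map_smul' := fun r φ => by
        have : dualStar (r • φ) = star r • dualStar φ := by ext; simp
        rw [this, map_smul, star_smul, star_star]; rfl } ‖F‖ fun φ => by
      change ‖star (F (dualStar φ))‖ ≤ _
      rw [norm_star]
      exact (F.le_opNorm _).trans
        (mul_le_mul_of_nonneg_left (norm_dualStar_le φ) (norm_nonneg _))⟩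

theorem star_apply (F : Bidual A) (φ : StrongDual ℂ A) : (star F) φ = star (F (dualStar φ)) := rfl

/-- The canonical embedding of `A` in its bidual is multiplicative and star preserving. -/
theorem inclusion_mul (a b : A) :
    NormedSpace.inclusionInDoubleDual ℂ A (a * b) =
      (NormedSpace.inclusionInDoubleDual ℂ A a * NormedSpace.inclusionInDoubleDual ℂ A b :
        Bidual A) := rfl

theorem inclusion_star (a : A) :
    NormedSpace.inclusionInDoubleDual ℂ A (star a) =
      (star (NormedSpace.inclusionInDoubleDual ℂ A a : Bidual A) : Bidual A) := by
  ext φ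
  simp [star_apply]

variable [PartialOrder A] [StarOrderedRing A]

/-- A positive functional as an element of the dual space. -/
def ofPositive (ω : A →ₚ[ℂ] ℂ) : StrongDual ℂ A := ⟨ω.toLinearMap, map_continuous ω⟩

/-- `p` is the support `s(ω)` of the positive functional `ω` in the bidual: the smallest projection
`p` of `A⋆⋆` with `ω(p) = ω(1)`, where `ω` is evaluated on the bidual by duality. -/
structure IsSupport (ω : A →ₚ[ℂ] ℂ) (p : Bidual A) : Prop where
  isStarProjection : IsStarProjection p
  apply_eq : p (ofPositive ω) = ω 1
  least : ∀ q : Bidual A, IsStarProjection q → q (ofPositive ω) = ω 1 → p * q = p ∧ q * p = p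

theorem IsSupport.unique {ω : A →ₚ[ℂ] ℂ} {p q : Bidual A} (hp : IsSupport ω p)
    (hq : IsSupport ω q) : p = q :=
  (hp.least q hq.isStarProjection hq.apply_eq).1.symm.trans
    (hq.least p hp.isStarProjection hp.apply_eq).2

end Bidual

end Bidual

/-! ### The Gelfand-Naimark-Segal representation -/

section GNS

variable {A : Type*} [CStarAlgebra A] [PartialOrder A] [StarOrderedRing A] (ω : A →ₚ[ℂ] ℂ)

/-- The cyclic vector `ξ_ω` of the GNS representation, that is the class of the unit. -/
def gnsVector : ω.GNS := ((ω.toPreGNS 1 : ω.PreGNS) : ω.GNS)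

/-- The von Neumann algebra `π_ω(A)''` generated by the GNS representation. -/
def gnsBicommutant : Set (ω.GNS →L[ℂ] ω.GNS) :=
  Set.centralizer (Set.centralizer (Set.range ω.gnsStarAlgHom))

end GNS

end

/-!
Put `ω = ω_μ` with GNS representation `π` and cyclic vector `ξ`, and let `T` in the bicommutant
of `π` kill `ξ`. If `‖π(a) η‖ ≤ ‖π(a) ζ‖` for all `a`, then `η` is the image of `ζ` under an
operator of the commutant, so `T ζ = 0` implies `T η = 0`. The state `ω` is the integral over `μ`
of the vector states `fiberState α z` of representations on `ℓ²(ℤ)`. Hence `π(W(m, 0)) ξ` induces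
`ω` itself, the closed span of these vectors is a copy of `L²(μ)`, and `s ∈ L²(μ)` induces the
integral of the fibre states over `|s|² μ`. The vector `π(W(m, n)) ξ` induces the integral over the
translate of `μ` under `R ^ (2 * n)`; this translate has a density with respect to `μ`, and the
square root of that density is a vector of `L²(μ)` inducing the same functional. So `T` kills all
`π(W(m, n)) ξ`, and `T = 0`.

For centrality, every functional is a combination of positive ones, so the bidual is the algebra of
bounded families of operators on the GNS spaces that commute with all intertwiners. The projections
onto the parts of the GNS spaces generated by `π` form such a family, the central cover of `π`. If
`ξ` is separating, a projection `q` of the bidual with `q(ω) = ω(1)` fixes `ξ`, hence acts as `1`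
in `π` and dominates the central cover, which is therefore the support of `ω`.
-/

noncomputable section

/-! ### Intertwiners -/

section Intertwiner

variable {A : Type*} [Ring A] [Algebra ℂ A] [StarRing A]
  {H K L : Type*} [NormedAddCommGroup H] [InnerProductSpace ℂ H] [CompleteSpace H]
  [NormedAddCommGroup K] [InnerProductSpace ℂ K] [CompleteSpace K]
  [NormedAddCommGroup L] [InnerProductSpace ℂ L] [CompleteSpace L]
  {π : A →⋆ₐ[ℂ] (H →L[ℂ] H)} {ρ : A →⋆ₐ[ℂ] (K →L[ℂ] K)} {σ : A →⋆ₐ[ℂ] (L →L[ℂ] L)}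

theorem inner_map_star_left (π : A →⋆ₐ[ℂ] (H →L[ℂ] H)) (a : A) (x y : H) :
    ⟪π (star a) x, y⟫_ℂ = ⟪x, π a y⟫_ℂ := by
  rw [map_star, ContinuousLinearMap.star_eq_adjoint, ContinuousLinearMap.adjoint_inner_left]

theorem inner_map_map (π : A →⋆ₐ[ℂ] (H →L[ℂ] H)) (a b : A) (x y : H) :
    ⟪π a x, π b y⟫_ℂ = ⟪x, π (star a * b) y⟫_ℂ := by
  rw [map_mul, mul_apply_eq_comp, ← inner_map_star_left π (star a), star_star]

/-- `C` intertwines the representations `π` and `ρ`. -/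
def IsIntertwiner (π : A →⋆ₐ[ℂ] (H →L[ℂ] H)) (ρ : A →⋆ₐ[ℂ] (K →L[ℂ] K)) (C : H →L[ℂ] K) :
    Prop :=
  ∀ a x, C (π a x) = ρ a (C x)

namespace IsIntertwiner

theorem comp {D : K →L[ℂ] L} {C : H →L[ℂ] K} (hD : IsIntertwiner ρ σ D)
    (hC : IsIntertwiner π ρ C) : IsIntertwiner π σ (D ∘L C) := fun a x => by
  simp only [ContinuousLinearMap.comp_apply, hC a x, hD a (C x)]

theorem adjoint {C : H →L[ℂ] K} (hC : IsIntertwiner π ρ C) :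
    IsIntertwiner ρ π (ContinuousLinearMap.adjoint C) := fun a x =>
  ext_inner_right ℂ fun y => by
    rw [ContinuousLinearMap.adjoint_inner_left, ← star_star a, inner_map_star_left,
      inner_map_star_left, ContinuousLinearMap.adjoint_inner_left, hC]

end IsIntertwiner

theorem mem_centralizer_range_iff_isIntertwiner {C : H →L[ℂ] H} :
    C ∈ Set.centralizer (Set.range π) ↔ IsIntertwiner π π C := by
  simp only [Set.mem_centralizer_iff, Set.forall_mem_range, ContinuousLinearMap.ext_iff]
  exact forall₂_congr fun _ _ => eq_comm

theorem exists_isIntertwiner_of_norm_le {x : H} {y : K} (hx : DenseRange fun a => π a x) {M : ℝ}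
    (hxy : ∀ a, ‖ρ a y‖ ≤ M * ‖π a x‖) : ∃ C, IsIntertwiner π ρ C ∧ C x = y := by
  let e : A →ₗ[ℂ] H := (ContinuousLinearMap.apply ℂ H x).toLinearMap ∘ₗ π.toLinearMap
  let f : A →ₗ[ℂ] K := (ContinuousLinearMap.apply ℂ K y).toLinearMap ∘ₗ ρ.toLinearMap
  have hC (a : A) : f.extendOfNorm e (π a x) = ρ a y :=
    LinearMap.extendOfNorm_eq (e := e) hx ⟨M, hxy⟩ a
  have hint (a : A) : f.extendOfNorm e ∘ π a = ρ a ∘ f.extendOfNorm e :=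
    hx.equalizer (by fun_prop) (by fun_prop) (funext fun b => by
      simp only [Function.comp_apply, hC, ← mul_apply_eq_comp, ← map_mul])
  exact ⟨f.extendOfNorm e, fun a => congrFun (hint a), by simpa using hC 1⟩

end Intertwiner

/-! ### Matrix coefficients -/

section MatrixCoefficient

variable {A : Type*} [CStarAlgebra A]
  {H K : Type*} [NormedAddCommGroup H] [InnerProductSpace ℂ H] [CompleteSpace H]
  [NormedAddCommGroup K] [InnerProductSpace ℂ K] [CompleteSpace K]

open scoped CStarAlgebra in
/-- The orbit map `a ↦ π(a) x` of the vector `x`. -/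
def orbitMap (π : A →⋆ₐ[ℂ] (H →L[ℂ] H)) : H →L[ℂ] A →L[ℂ] H :=
  ContinuousLinearMap.flip ⟨π.toLinearMap, map_continuous π⟩

theorem orbitMap_apply (π : A →⋆ₐ[ℂ] (H →L[ℂ] H)) (x : H) (a : A) : orbitMap π x a = π a x := rfl

/-- The matrix coefficient `a ↦ ⟪x, π(a) y⟫`, as a bounded sesquilinear function of `(x, y)`. -/
def matrixCoeff (π : A →⋆ₐ[ℂ] (H →L[ℂ] H)) : H →L⋆[ℂ] H →L[ℂ] StrongDual ℂ A :=
  ((ContinuousLinearMap.compL ℂ H (A →L[ℂ] H) (StrongDual ℂ A)).flip (orbitMap π)).comp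
    ((ContinuousLinearMap.compL ℂ A H ℂ).comp (innerSL ℂ))

@[simp] theorem matrixCoeff_apply (π : A →⋆ₐ[ℂ] (H →L[ℂ] H)) (x y : H) (a : A) :
    matrixCoeff π x y a = ⟪x, π a y⟫_ℂ := rfl

theorem IsIntertwiner.matrixCoeff_adjoint {π : A →⋆ₐ[ℂ] (H →L[ℂ] H)}
    {ρ : A →⋆ₐ[ℂ] (K →L[ℂ] K)} {C : H →L[ℂ] K} (hC : IsIntertwiner π ρ C) (x : K) (y : H) :
    matrixCoeff π (ContinuousLinearMap.adjoint C x) y = matrixCoeff ρ x (C y) := by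
  ext a
  rw [matrixCoeff_apply, matrixCoeff_apply, ContinuousLinearMap.adjoint_inner_left, hC]

theorem matrixCoeff_map_map (π : A →⋆ₐ[ℂ] (H →L[ℂ] H)) (b : A) (x y : H) (a : A) :
    matrixCoeff π (π b x) (π b y) a = matrixCoeff π x y (star b * a * b) := by
  rw [matrixCoeff_apply, matrixCoeff_apply, ← mul_apply_eq_comp, ← map_mul, inner_map_map,
    mul_assoc]

theorem matrixCoeff_smul_smul (π : A →⋆ₐ[ℂ] (H →L[ℂ] H)) (c : ℂ) (x y : H) (a : A) :
    matrixCoeff π (c • x) (c • y) a = ‖c‖ ^ 2 • matrixCoeff π x y a := by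
  rw [matrixCoeff_apply, matrixCoeff_apply, map_smul, inner_smul_left, inner_smul_right,
    ← mul_assoc, RCLike.conj_mul, Complex.real_smul, Complex.ofReal_pow]
  rfl

variable [PartialOrder A] [StarOrderedRing A]

/-- The positive functional `a ↦ ⟪x, π(a) x⟫`. -/
def vectorFunctional (π : A →⋆ₐ[ℂ] (H →L[ℂ] H)) (x : H) : A →ₚ[ℂ] ℂ :=
  PositiveLinearMap.mk₀ (matrixCoeff π x x).toLinearMap fun a ha => by
    obtain ⟨b, rfl⟩ := CStarAlgebra.nonneg_iff_eq_star_mul_self.mp ha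
    change 0 ≤ ⟪x, π (star b * b) x⟫_ℂ
    rw [← inner_map_map, inner_self_eq_norm_sq_to_K]
    positivity

theorem vectorFunctional_star_mul_self (π : A →⋆ₐ[ℂ] (H →L[ℂ] H)) (x : H) (a : A) :
    vectorFunctional π x (star a * a) = (‖π a x‖ : ℂ) ^ 2 :=
  (inner_map_map π a a x x).symm.trans (inner_self_eq_norm_sq_to_K (π a x))

end MatrixCoefficient

/-! ### Functionals and intertwiners of GNS representations -/

section GNS

variable {A : Type*} [CStarAlgebra A] [PartialOrder A] [StarOrderedRing A]
  {K : Type*} [NormedAddCommGroup K] [InnerProductSpace ℂ K] [CompleteSpace K]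
  (ω : A →ₚ[ℂ] ℂ)

theorem gnsStarAlgHom_gnsVector (a : A) :
    ω.gnsStarAlgHom a (gnsVector ω) = ((ω.toPreGNS a : ω.PreGNS) : ω.GNS) := by
  change ω.gnsNonUnitalStarAlgHom a ((ω.toPreGNS 1 : ω.PreGNS) : ω.GNS) = _
  simp only [PositiveLinearMap.gnsNonUnitalStarAlgHom_apply_coe,
    PositiveLinearMap.leftMulMapPreGNS_apply, PositiveLinearMap.ofPreGNS_toPreGNS, mul_one]

theorem denseRange_gnsStarAlgHom_gnsVector :
    DenseRange fun a => ω.gnsStarAlgHom a (gnsVector ω) := by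
  simp only [gnsStarAlgHom_gnsVector]
  exact UniformSpace.Completion.denseRange_coe (α := ω.PreGNS)

theorem inner_gnsStarAlgHom_gnsVector (a b : A) :
    ⟪ω.gnsStarAlgHom a (gnsVector ω), ω.gnsStarAlgHom b (gnsVector ω)⟫_ℂ = ω (star a * b) := by
  rw [gnsStarAlgHom_gnsVector, gnsStarAlgHom_gnsVector, UniformSpace.Completion.inner_coe]
  rfl

theorem matrixCoeff_gnsVector :
    matrixCoeff ω.gnsStarAlgHom (gnsVector ω) (gnsVector ω) = Bidual.ofPositive ω := by
  ext a
  have := inner_gnsStarAlgHom_gnsVector ω 1 a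
  rwa [map_one, star_one, one_mul] at this

theorem norm_gnsStarAlgHom_gnsVector_sq (a : A) :
    (‖ω.gnsStarAlgHom a (gnsVector ω)‖ : ℂ) ^ 2 = ω (star a * a) := by
  rw [← inner_gnsStarAlgHom_gnsVector, inner_self_eq_norm_sq_to_K]
  rfl

theorem norm_gnsStarAlgHom_gnsStarAlgHom_gnsVector_sq (a b : A) :
    (‖ω.gnsStarAlgHom a (ω.gnsStarAlgHom b (gnsVector ω))‖ : ℂ) ^ 2 =
      ω (star b * (star a * a) * b) := by
  rw [← mul_apply_eq_comp, ← map_mul, norm_gnsStarAlgHom_gnsVector_sq, star_mul]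
  simp only [mul_assoc]

theorem norm_gnsVector_sq : (‖gnsVector ω‖ : ℂ) ^ 2 = ω 1 := by
  simpa only [map_one, star_one, mul_one, one_apply_eq_self] using
    norm_gnsStarAlgHom_gnsVector_sq ω 1

theorem exists_isometry_gns_vectorFunctional (π : A →⋆ₐ[ℂ] (K →L[ℂ] K)) (x : K) :
    ∃ C, IsIntertwiner (vectorFunctional π x).gnsStarAlgHom π C ∧
      C (gnsVector (vectorFunctional π x)) = x ∧ ContinuousLinearMap.adjoint C ∘L C = 1 := by
  have hnorm (a : A) :
      ‖π a x‖ = ‖(vectorFunctional π x).gnsStarAlgHom a (gnsVector (vectorFunctional π x))‖ := by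
    rw [← sq_eq_sq₀ (norm_nonneg _) (norm_nonneg _)]
    exact_mod_cast ((norm_gnsStarAlgHom_gnsVector_sq _ a).trans
      (vectorFunctional_star_mul_self π x a)).symm
  have hdense := denseRange_gnsStarAlgHom_gnsVector (vectorFunctional π x)
  obtain ⟨C, hC, hCx⟩ := exists_isIntertwiner_of_norm_le hdense (ρ := π) (y := x) (M := 1)
    fun a => by rw [one_mul, hnorm]
  have hisom : norm ∘ C = norm :=
    hdense.equalizer (by fun_prop) (by fun_prop) (funext fun a => by
      simp only [Function.comp_apply, hC a, hCx, hnorm])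
  exact ⟨C, hC, hCx, C.norm_map_iff_adjoint_comp_self.mp (congrFun hisom)⟩

end GNS

section Separating

variable {A : Type*} [CStarAlgebra A] [PartialOrder A] [StarOrderedRing A]
  {H : Type*} [NormedAddCommGroup H] [InnerProductSpace ℂ H] [CompleteSpace H]

/-- The vector `x` is separating for the set `M` of operators: no nonzero element of `M` kills
it. -/
def IsSeparatingVector (M : Set (H →L[ℂ] H)) (x : H) : Prop :=
  ∀ T ∈ M, T x = 0 → T = 0

theorem exists_mem_centralizer_apply_eq {π : A →⋆ₐ[ℂ] (H →L[ℂ] H)} {x y : H}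
    (hxy : ∀ a, ‖π a y‖ ≤ ‖π a x‖) : ∃ C ∈ Set.centralizer (Set.range π), C x = y := by
  obtain ⟨C, hC, hCx, hCC⟩ := exists_isometry_gns_vectorFunctional π x
  obtain ⟨D, hD, hDy⟩ := exists_isIntertwiner_of_norm_le (ρ := π) (y := y) (M := 1)
    (denseRange_gnsStarAlgHom_gnsVector (vectorFunctional π x)) fun a => by
      rw [one_mul, ← C.norm_map_iff_adjoint_comp_self.mpr hCC, hC, hCx]
      exact hxy a
  refine ⟨D ∘L ContinuousLinearMap.adjoint C,
    mem_centralizer_range_iff_isIntertwiner.mpr (hD.comp hC.adjoint), ?_⟩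
  calc D (ContinuousLinearMap.adjoint C x)
      = D ((ContinuousLinearMap.adjoint C ∘L C) (gnsVector (vectorFunctional π x))) := by
        rw [ContinuousLinearMap.comp_apply, hCx]
    _ = y := by rw [hCC, one_apply_eq_self, hDy]

theorem apply_eq_zero_of_norm_le {π : A →⋆ₐ[ℂ] (H →L[ℂ] H)} {x y : H}
    (hxy : ∀ a, ‖π a y‖ ≤ ‖π a x‖) {T : H →L[ℂ] H}
    (hT : T ∈ Set.centralizer (Set.centralizer (Set.range π))) (hx : T x = 0) : T y = 0 := by
  obtain ⟨C, hC, rfl⟩ := exists_mem_centralizer_apply_eq hxy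
  rw [← mul_apply_eq_comp, ← hT C hC, mul_apply_eq_comp, hx, map_zero]

end Separating

/-! ### Extension of representations to the bidual -/

section BidualRep

variable {A : Type*} [CStarAlgebra A]
  {H K : Type*} [NormedAddCommGroup H] [InnerProductSpace ℂ H] [CompleteSpace H]
  [NormedAddCommGroup K] [InnerProductSpace ℂ K] [CompleteSpace K]

/-- The extension of a representation `π` of `A` to the bidual, determined by
`⟪x, bidualRep π F y⟫ = F(⟪x, π(·) y⟫)`. -/
def bidualRep (π : A →⋆ₐ[ℂ] (H →L[ℂ] H)) (F : Bidual A) : H →L[ℂ] H :=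
  ContinuousLinearMap.adjoint (InnerProductSpace.continuousLinearMapOfBilin
    ((ContinuousLinearMap.compL ℂ H (StrongDual ℂ A) ℂ F).comp (matrixCoeff π)))

theorem inner_bidualRep (π : A →⋆ₐ[ℂ] (H →L[ℂ] H)) (F : Bidual A) (x y : H) :
    ⟪x, bidualRep π F y⟫_ℂ = F (matrixCoeff π x y) := by
  rw [bidualRep, ContinuousLinearMap.adjoint_inner_right,
    InnerProductSpace.continuousLinearMapOfBilin_apply]
  rfl

theorem dualMul_matrixCoeff (π : A →⋆ₐ[ℂ] (H →L[ℂ] H)) (x y : H) (a : A) :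
    Bidual.dualMul (matrixCoeff π x y) a = matrixCoeff π (π (star a) x) y := by
  ext b
  rw [Bidual.dualMul_apply, matrixCoeff_apply, matrixCoeff_apply, inner_map_map, star_star,
    map_mul]

theorem dualStar_matrixCoeff (π : A →⋆ₐ[ℂ] (H →L[ℂ] H)) (x y : H) :
    dualStar (matrixCoeff π x y) = matrixCoeff π y x := by
  ext a
  rw [dualStar_apply, matrixCoeff_apply, matrixCoeff_apply, ← inner_map_star_left, star_star]
  exact inner_conj_symm _ _

theorem act_matrixCoeff (π : A →⋆ₐ[ℂ] (H →L[ℂ] H)) (F : Bidual A) (x y : H) :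
    Bidual.act F (matrixCoeff π x y) = matrixCoeff π x (bidualRep π F y) := by
  ext a
  rw [Bidual.act_apply, dualMul_matrixCoeff, ← inner_bidualRep, inner_map_star_left,
    matrixCoeff_apply]

theorem bidualRep_mul (π : A →⋆ₐ[ℂ] (H →L[ℂ] H)) (F G : Bidual A) :
    bidualRep π (F * G) = bidualRep π F * bidualRep π G := by
  ext y
  refine ext_inner_left ℂ fun x => ?_
  rw [inner_bidualRep, Bidual.mul_apply, act_matrixCoeff, ← inner_bidualRep, mul_apply_eq_comp]

theorem bidualRep_star (π : A →⋆ₐ[ℂ] (H →L[ℂ] H)) (F : Bidual A) :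
    bidualRep π (star F) = star (bidualRep π F) := by
  ext y
  refine ext_inner_left ℂ fun x => ?_
  rw [inner_bidualRep, Bidual.star_apply, dualStar_matrixCoeff, ← inner_bidualRep,
    ContinuousLinearMap.star_eq_adjoint, ContinuousLinearMap.adjoint_inner_right]
  exact inner_conj_symm _ _

theorem isStarProjection_bidualRep (π : A →⋆ₐ[ℂ] (H →L[ℂ] H)) {p : Bidual A}
    (hp : IsStarProjection p) : IsStarProjection (bidualRep π p) where
  isIdempotentElem := by rw [IsIdempotentElem, ← bidualRep_mul, hp.isIdempotentElem.eq]
  isSelfAdjoint := by rw [IsSelfAdjoint, ← bidualRep_star, hp.isSelfAdjoint.star_eq]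

theorem IsIntertwiner.bidualRep {π : A →⋆ₐ[ℂ] (H →L[ℂ] H)} {ρ : A →⋆ₐ[ℂ] (K →L[ℂ] K)}
    {C : H →L[ℂ] K} (hC : IsIntertwiner π ρ C) (F : Bidual A) (x : H) :
    C (bidualRep π F x) = bidualRep ρ F (C x) := by
  refine ext_inner_left ℂ fun y => ?_
  rw [inner_bidualRep, ← ContinuousLinearMap.adjoint_inner_left, inner_bidualRep,
    hC.matrixCoeff_adjoint]

theorem bidualRep_mem_bicommutant (π : A →⋆ₐ[ℂ] (H →L[ℂ] H)) (F : Bidual A) :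
    bidualRep π F ∈ Set.centralizer (Set.centralizer (Set.range π)) := fun _ hC =>
  ContinuousLinearMap.ext fun x =>
    (mem_centralizer_range_iff_isIntertwiner.mp hC).bidualRep F x

end BidualRep

/-! ### Jordan decomposition of functionals -/

section OrderedNormedSpace

variable {E : Type*} [SeminormedAddCommGroup E] [NormedSpace ℝ E] [PartialOrder E]
  [IsOrderedAddMonoid E] [PosSMulMono ℝ E]

/-- The cone generated by the pairs `(x, 0)` and `(x, -ψ x)` with `0 ≤ x` and by all pairs
`(x, C * ‖x‖)`. A functional `(x, t) ↦ g x + t` is nonnegative on it when `0 ≤ g x` and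
`ψ x ≤ g x` for `0 ≤ x`, and `g x ≤ C * ‖x‖` for all `x`. -/
def majorantCone (ψ : E →ₗ[ℝ] ℝ) {C : ℝ} (hC : 0 ≤ C) : PointedCone ℝ (E × ℝ) where
  carrier := {p | ∃ w v, 0 ≤ w ∧ w + v ≤ p.1 ∧ C * ‖v‖ - ψ w ≤ p.2}
  zero_mem' := ⟨0, 0, by simp⟩
  add_mem' := by
    rintro p q ⟨w, v, hw, hp₁, hp₂⟩ ⟨w', v', hw', hq₁, hq₂⟩
    refine ⟨w + w', v + v', add_nonneg hw hw', ?_, ?_⟩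
    · rw [add_add_add_comm]
      exact add_le_add hp₁ hq₁
    · rw [map_add, Prod.snd_add]
      nlinarith [mul_le_mul_of_nonneg_left (norm_add_le v v') hC]
  smul_mem' := by
    rintro ⟨c, hc⟩ p ⟨w, v, hw, hp₁, hp₂⟩
    refine ⟨c • w, c • v, smul_nonneg hc hw, ?_, ?_⟩
    · rw [← smul_add]
      exact smul_le_smul_of_nonneg_left hp₁ hc
    · rw [map_smul, norm_smul, Real.norm_of_nonneg hc, smul_eq_mul]
      exact (by ring : C * (c * ‖v‖) - c * ψ w = c * (C * ‖v‖ - ψ w)).trans_le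
        (mul_le_mul_of_nonneg_left hp₂ hc)

theorem exists_positive_majorant
    (hmono : ∀ x y : E, 0 ≤ x → x ≤ y → ‖x‖ ≤ ‖y‖) (ψ : E →ₗ[ℝ] ℝ) {C : ℝ} (hC : 0 ≤ C)
    (hψ : ∀ x, ψ x ≤ C * ‖x‖) :
    ∃ g : E →ₗ[ℝ] ℝ, (∀ x, 0 ≤ x → 0 ≤ g x) ∧ (∀ x, 0 ≤ x → ψ x ≤ g x) ∧
      ∀ x, g x ≤ C * ‖x‖ := by
  let f : E × ℝ →ₗ.[ℝ] ℝ :=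
    ⟨Submodule.prod ⊥ ⊤, LinearMap.snd ℝ E ℝ ∘ₗ Submodule.subtype _⟩
  obtain ⟨F, hFf, hF⟩ := riesz_extension (majorantCone ψ hC) f
    (by
      rintro ⟨p, hp, _⟩ ⟨w, v, hw, hwv, ht⟩
      rw [show p.1 = 0 from hp, ← le_neg_iff_add_nonpos_right] at hwv
      change 0 ≤ p.2
      have hwv_norm : ‖w‖ ≤ ‖v‖ := norm_neg v ▸ hmono w (-v) hw hwv
      linarith [hψ w, mul_le_mul_of_nonneg_left hwv_norm hC])
    (by
      rintro ⟨x, t⟩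
      exact ⟨⟨(0, C * ‖x‖ - t), rfl, trivial⟩, 0, x, by simp⟩)
  have hFsnd (t : ℝ) : F (0, t) = t := hFf ⟨(0, t), rfl, trivial⟩
  have hFadd (x : E) (t : ℝ) : F (x, t) = F (x, 0) + t := by
    rw [← hFsnd t, ← map_add, Prod.mk_add_mk, add_zero, zero_add, hFsnd]
  refine ⟨F ∘ₗ LinearMap.inl ℝ E ℝ, fun x hx => hF (x, 0) ⟨0, 0, by simpa using hx⟩,
    fun x hx => ?_, fun x => ?_⟩
  · have := hF (x, -ψ x) ⟨x, 0, by simpa using hx⟩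
    rw [hFadd] at this
    exact sub_nonneg.mp this
  · have := hF (-x, C * ‖x‖) ⟨0, -x, by simp⟩
    rw [hFadd, show (-x, (0 : ℝ)) = -(x, 0) by simp, map_neg, neg_add_eq_sub] at this
    exact sub_nonneg.mp this

end OrderedNormedSpace

section Jordan

variable {A : Type*} [CStarAlgebra A]

/-- The complex linear extension of a real functional on the self-adjoint part. -/
def complexExtension (g : A →ₗ[ℝ] ℝ) : A →ₗ[ℂ] ℂ :=
  Module.Dual.extendRCLike (g ∘ₗ (selfAdjoint.submodule ℝ A).subtype ∘ₗ realPart)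

theorem complexExtension_of_isSelfAdjoint (g : A →ₗ[ℝ] ℝ) {a : A} (ha : IsSelfAdjoint a) :
    complexExtension g a = g a := by
  have him : realPart (Complex.I • a) = 0 := by rw [realPart_I_smul, ha.imaginaryPart, neg_zero]
  rw [complexExtension, Module.Dual.extendRCLike_apply]
  change (g (realPart a : A) : ℂ) - Complex.I * (g (realPart (Complex.I • a) : A) : ℂ) = g a
  rw [ha.coe_realPart, him, ZeroMemClass.coe_zero, map_zero, Complex.ofReal_zero, mul_zero,
    sub_zero]

theorem exists_hermitian_decomposition (ψ : StrongDual ℂ A) :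
    ∃ φ₁ φ₂ : StrongDual ℂ A, ψ = φ₁ + Complex.I • φ₂ ∧ dualStar φ₁ = φ₁ ∧ dualStar φ₂ = φ₂ ∧
      ‖φ₁‖ ≤ ‖ψ‖ ∧ ‖φ₂‖ ≤ ‖ψ‖ := by
  have hstar := norm_dualStar_le ψ
  refine ⟨(2⁻¹ : ℂ) • (ψ + dualStar ψ), (-Complex.I * 2⁻¹ : ℂ) • (ψ - dualStar ψ),
    ?_, ?_, ?_, ?_, ?_⟩
  · ext a
    simp only [add_apply, smul_apply, sub_apply, smul_eq_mul]
    linear_combination ((ψ a - dualStar ψ a) / 2) * Complex.I_mul_I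
  · ext a
    simp [add_comm]
  · ext a
    simp only [dualStar_apply, smul_apply, sub_apply, smul_eq_mul, star_mul', star_sub,
      star_star, star_neg, RCLike.star_def, Complex.conj_I, map_inv₀, map_ofNat,
      starRingEnd_self_apply]
    ring
  · rw [norm_smul, norm_inv, Complex.norm_ofNat]
    linarith [norm_add_le ψ (dualStar ψ)]
  · rw [norm_smul, norm_mul, norm_neg, Complex.norm_I, norm_inv, Complex.norm_ofNat]
    linarith [norm_sub_le ψ (dualStar ψ)]

variable [PartialOrder A] [StarOrderedRing A]

theorem im_apply_eq_zero_of_dualStar_eq {φ : StrongDual ℂ A} (hφ : dualStar φ = φ) {a : A}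
    (ha : 0 ≤ a) : (φ a).im = 0 := by
  have := DFunLike.congr_fun hφ a
  rw [dualStar_apply, (IsSelfAdjoint.of_nonneg ha).star_eq] at this
  exact Complex.conj_eq_iff_im.mp this

theorem exists_positive_sub (ψ : StrongDual ℂ A) (hψ : ∀ a : A, 0 ≤ a → (ψ a).im = 0) :
    ∃ g h : A →ₚ[ℂ] ℂ, ψ = Bidual.ofPositive g - Bidual.ofPositive h ∧
      (g 1).re ≤ ‖ψ‖ * ‖(1 : A)‖ ∧ (h 1).re ≤ 2 * ‖ψ‖ * ‖(1 : A)‖ := by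
  have hψ_re (a : A) : |(ψ a).re| ≤ ‖ψ‖ * ‖a‖ := (Complex.abs_re_le_norm _).trans (ψ.le_opNorm a)
  obtain ⟨g, hg, hψg, hg_norm⟩ := exists_positive_majorant
    (fun _ _ h => CStarAlgebra.norm_le_norm_of_nonneg_of_le h)
    (Complex.reLm ∘ₗ ψ.toLinearMap.restrictScalars ℝ) (norm_nonneg ψ)
    fun a => (le_abs_self _).trans (hψ_re a)
  have hgC {a : A} (ha : 0 ≤ a) : complexExtension g a = g a :=
    complexExtension_of_isSelfAdjoint g (.of_nonneg ha)
  let g' : A →ₚ[ℂ] ℂ := PositiveLinearMap.mk₀ (complexExtension g) fun a ha => by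
    rw [hgC ha]
    exact_mod_cast hg a ha
  let h' : A →ₚ[ℂ] ℂ := PositiveLinearMap.mk₀ (complexExtension g - ψ.toLinearMap) fun a ha => by
    have : ψ a = ((ψ a).re : ℂ) := Complex.ext rfl (hψ a ha)
    change 0 ≤ complexExtension g a - ψ a
    rw [hgC ha, this]
    exact_mod_cast sub_nonneg.mpr (hψg a ha)
  have hg1 : (g' 1).re ≤ ‖ψ‖ * ‖(1 : A)‖ := by
    change (complexExtension g 1).re ≤ _
    rw [hgC zero_le_one, Complex.ofReal_re]
    exact hg_norm 1
  refine ⟨g', h', ?_, hg1, ?_⟩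
  · ext a
    exact (sub_sub_cancel (complexExtension g a) (ψ a)).symm
  · have : (h' 1).re = (g' 1).re - (ψ 1).re := rfl
    linarith [neg_le_of_abs_le (hψ_re 1)]

theorem exists_positive_decomposition (ψ : StrongDual ℂ A) :
    ∃ g₁ g₂ g₃ g₄ : A →ₚ[ℂ] ℂ,
      ψ = Bidual.ofPositive g₁ - Bidual.ofPositive g₂ +
        Complex.I • (Bidual.ofPositive g₃ - Bidual.ofPositive g₄) ∧
      (g₁ 1).re + (g₂ 1).re + (g₃ 1).re + (g₄ 1).re ≤ 6 * ‖(1 : A)‖ * ‖ψ‖ := by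
  obtain ⟨φ₁, φ₂, hψ, h₁, h₂, n₁, n₂⟩ := exists_hermitian_decomposition ψ
  obtain ⟨g₁, g₂, hg, b₁, b₂⟩ := exists_positive_sub φ₁ fun _ => im_apply_eq_zero_of_dualStar_eq h₁
  obtain ⟨g₃, g₄, hg', b₃, b₄⟩ := exists_positive_sub φ₂ fun _ => im_apply_eq_zero_of_dualStar_eq h₂
  refine ⟨g₁, g₂, g₃, g₄, by rw [hψ, hg, hg'], ?_⟩
  nlinarith [norm_nonneg (1 : A)]

end Jordan

/-! ### The bidual as the algebra of bounded natural families of operators -/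

section NaturalFamily

variable {A : Type*} [CStarAlgebra A] [PartialOrder A] [StarOrderedRing A]

theorem Bidual.apply_ofPositive (F : Bidual A) (g : A →ₚ[ℂ] ℂ) :
    F (Bidual.ofPositive g) = ⟪gnsVector g, bidualRep g.gnsStarAlgHom F (gnsVector g)⟫_ℂ := by
  rw [inner_bidualRep, matrixCoeff_gnsVector]

theorem Bidual.ext_gns {F G : Bidual A}
    (h : ∀ g : A →ₚ[ℂ] ℂ, bidualRep g.gnsStarAlgHom F = bidualRep g.gnsStarAlgHom G) : F = G := by
  have hpos (g : A →ₚ[ℂ] ℂ) : F (Bidual.ofPositive g) = G (Bidual.ofPositive g) := by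
    rw [Bidual.apply_ofPositive, Bidual.apply_ofPositive, h]
  ext ψ
  obtain ⟨g₁, g₂, g₃, g₄, rfl, -⟩ := exists_positive_decomposition ψ
  simp only [map_add, map_sub, map_smul, hpos]

theorem exists_isIntertwiner_gns_of_le {g h : A →ₚ[ℂ] ℂ} (hgh : ∀ a, 0 ≤ a → g a ≤ h a) :
    ∃ C, IsIntertwiner h.gnsStarAlgHom g.gnsStarAlgHom C ∧ C (gnsVector h) = gnsVector g := by
  refine exists_isIntertwiner_of_norm_le (M := 1) (denseRange_gnsStarAlgHom_gnsVector h) fun a => ?_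
  rw [one_mul, ← sq_le_sq₀ (norm_nonneg _) (norm_nonneg _)]
  have := hgh (star a * a) (star_mul_self_nonneg a)
  rw [← norm_gnsStarAlgHom_gnsVector_sq, ← norm_gnsStarAlgHom_gnsVector_sq] at this
  exact_mod_cast this

theorem norm_inner_gnsVector_le {g : A →ₚ[ℂ] ℂ} {M : ℝ} {S : g.GNS →L[ℂ] g.GNS} (hS : ‖S‖ ≤ M) :
    ‖⟪gnsVector g, S (gnsVector g)⟫_ℂ‖ ≤ M * (g 1).re := by
  have hg : (g 1).re = ‖gnsVector g‖ ^ 2 := by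
    rw [← norm_gnsVector_sq, ← Complex.ofReal_pow, Complex.ofReal_re]
  calc ‖⟪gnsVector g, S (gnsVector g)⟫_ℂ‖ ≤ ‖gnsVector g‖ * (M * ‖gnsVector g‖) :=
        (norm_inner_le_norm _ _).trans (by gcongr; exact S.le_of_opNorm_le hS _)
    _ = M * (g 1).re := by rw [hg]; ring

/-- A family of operators on the GNS spaces of the positive functionals is natural if it commutes
with all intertwiners between GNS representations. The bounded natural families are the elements
of the bidual. -/
def IsNaturalFamily (T : ∀ g : A →ₚ[ℂ] ℂ, g.GNS →L[ℂ] g.GNS) : Prop :=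
  ∀ (g h : A →ₚ[ℂ] ℂ) (C : g.GNS →L[ℂ] h.GNS),
    IsIntertwiner g.gnsStarAlgHom h.gnsStarAlgHom C → ∀ x, C (T g x) = T h (C x)

variable {T : ∀ g : A →ₚ[ℂ] ℂ, g.GNS →L[ℂ] g.GNS}

namespace IsNaturalFamily

/-- The graph of the functional `⟪ζ, π_g(·) ξ_g⟫ ↦ ⟪ζ, T_g ξ_g⟫` on the dual of `A`. -/
def graph (hT : IsNaturalFamily T) : Submodule ℂ (StrongDual ℂ A × ℂ) where
  carrier := {p | ∃ (g : A →ₚ[ℂ] ℂ) (ζ : g.GNS),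
    p = (matrixCoeff g.gnsStarAlgHom ζ (gnsVector g), ⟪ζ, T g (gnsVector g)⟫_ℂ)}
  zero_mem' := ⟨0, 0, by rw [map_zero, zero_apply, inner_zero_left, Prod.mk_zero_zero]⟩
  add_mem' := by
    rintro _ _ ⟨g, ζ, rfl⟩ ⟨h, η, rfl⟩
    obtain ⟨C, hC, hCξ⟩ := exists_isIntertwiner_gns_of_le (g := g) (h := g + h)
      fun a ha => le_add_of_nonneg_right (h.map_nonneg ha)
    obtain ⟨D, hD, hDξ⟩ := exists_isIntertwiner_gns_of_le (g := h) (h := g + h)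
      fun a ha => le_add_of_nonneg_left (g.map_nonneg ha)
    refine ⟨g + h, ContinuousLinearMap.adjoint C ζ + ContinuousLinearMap.adjoint D η, ?_⟩
    rw [map_add, add_apply, hC.matrixCoeff_adjoint, hD.matrixCoeff_adjoint, inner_add_left,
      ContinuousLinearMap.adjoint_inner_left, ContinuousLinearMap.adjoint_inner_left, hT _ _ C hC,
      hT _ _ D hD, hCξ, hDξ, Prod.mk_add_mk]
  smul_mem' := by
    rintro r _ ⟨g, ζ, rfl⟩
    refine ⟨g, star r • ζ, ?_⟩
    rw [ContinuousLinearMap.map_smulₛₗ, inner_smul_left, RCLike.star_def, Complex.conj_conj,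
      smul_apply, Prod.smul_mk, smul_eq_mul]

theorem mk_matrixCoeff_mem_graph (hT : IsNaturalFamily T) (g : A →ₚ[ℂ] ℂ) (x y : g.GNS) :
    (matrixCoeff g.gnsStarAlgHom x y, ⟪x, T g y⟫_ℂ) ∈ hT.graph := by
  obtain ⟨C, hC, hCξ, -⟩ := exists_isometry_gns_vectorFunctional g.gnsStarAlgHom y
  refine ⟨vectorFunctional g.gnsStarAlgHom y, ContinuousLinearMap.adjoint C x, ?_⟩
  rw [hC.matrixCoeff_adjoint, ContinuousLinearMap.adjoint_inner_left, hT _ _ C hC, hCξ]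

theorem eq_of_mem_graph (hT : IsNaturalFamily T) {ψ : StrongDual ℂ A} {c d : ℂ}
    (hc : (ψ, c) ∈ hT.graph) (hd : (ψ, d) ∈ hT.graph) : c = d := by
  have hsub := hT.graph.sub_mem hc hd
  rw [Prod.mk_sub_mk, sub_self] at hsub
  obtain ⟨g, ζ, hζ⟩ := hsub
  obtain ⟨h0, hcd⟩ := Prod.mk.inj hζ
  have hζ0 : ζ = 0 := (denseRange_gnsStarAlgHom_gnsVector g).eq_zero_of_inner_left ℂ fun a =>
    (DFunLike.congr_fun h0 a).symm
  rwa [hζ0, inner_zero_left, sub_eq_zero] at hcd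

theorem exists_mem_graph (hT : IsNaturalFamily T) {M : ℝ} (hM : ∀ g, ‖T g‖ ≤ M)
    (ψ : StrongDual ℂ A) : ∃ c, (ψ, c) ∈ hT.graph ∧ ‖c‖ ≤ M * (6 * ‖(1 : A)‖) * ‖ψ‖ := by
  have hM0 : 0 ≤ M := (norm_nonneg (T 0)).trans (hM 0)
  obtain ⟨g₁, g₂, g₃, g₄, hψ, hg⟩ := exists_positive_decomposition ψ
  let c (g : A →ₚ[ℂ] ℂ) : ℂ := ⟪gnsVector g, T g (gnsVector g)⟫_ℂ
  have hc (g : A →ₚ[ℂ] ℂ) : (Bidual.ofPositive g, c g) ∈ hT.graph :=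
    ⟨g, gnsVector g, by rw [matrixCoeff_gnsVector]⟩
  refine ⟨c g₁ - c g₂ + Complex.I • (c g₃ - c g₄), ?_, ?_⟩
  · rw [hψ]
    exact hT.graph.add_mem (hT.graph.sub_mem (hc g₁) (hc g₂))
      (hT.graph.smul_mem _ (hT.graph.sub_mem (hc g₃) (hc g₄)))
  calc ‖c g₁ - c g₂ + Complex.I • (c g₃ - c g₄)‖
      ≤ ‖c g₁ - c g₂‖ + ‖c g₃ - c g₄‖ := by
        simpa only [norm_smul, Complex.norm_I, one_mul] using
          norm_add_le (c g₁ - c g₂) (Complex.I • (c g₃ - c g₄))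
    _ ≤ (‖c g₁‖ + ‖c g₂‖) + (‖c g₃‖ + ‖c g₄‖) := add_le_add (norm_sub_le _ _) (norm_sub_le _ _)
    _ ≤ M * ((g₁ 1).re + (g₂ 1).re + (g₃ 1).re + (g₄ 1).re) := by
        linarith [norm_inner_gnsVector_le (hM g₁), norm_inner_gnsVector_le (hM g₂),
          norm_inner_gnsVector_le (hM g₃), norm_inner_gnsVector_le (hM g₄)]
    _ ≤ M * (6 * ‖(1 : A)‖) * ‖ψ‖ := by
        rw [mul_assoc]
        exact mul_le_mul_of_nonneg_left hg hM0

theorem exists_bidualRep_eq (hT : IsNaturalFamily T) {M : ℝ} (hM : ∀ g, ‖T g‖ ≤ M) :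
    ∃ F : Bidual A, ∀ g, bidualRep g.gnsStarAlgHom F = T g := by
  choose c hc hcM using hT.exists_mem_graph hM
  let F : Bidual A := LinearMap.mkContinuous
    { toFun := c
      map_add' := fun ψ φ => hT.eq_of_mem_graph (hc _) (hT.graph.add_mem (hc ψ) (hc φ))
      map_smul' := fun r ψ => hT.eq_of_mem_graph (hc _) (hT.graph.smul_mem r (hc ψ)) }
    (M * (6 * ‖(1 : A)‖)) hcM
  refine ⟨F, fun g => ?_⟩
  ext y
  refine ext_inner_left ℂ fun x => ?_
  rw [inner_bidualRep]
  exact hT.eq_of_mem_graph (hc _) (hT.mk_matrixCoeff_mem_graph g x y)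

end IsNaturalFamily

end NaturalFamily

/-! ### The central cover of a representation -/

section CentralCover

variable {A : Type*} [CStarAlgebra A]
  {H K L : Type*} [NormedAddCommGroup H] [InnerProductSpace ℂ H] [CompleteSpace H]
  [NormedAddCommGroup K] [InnerProductSpace ℂ K] [CompleteSpace K]
  [NormedAddCommGroup L] [InnerProductSpace ℂ L] [CompleteSpace L]

theorem map_starProjection {p : Submodule ℂ H} {q : Submodule ℂ K} [p.HasOrthogonalProjection]
    [q.HasOrthogonalProjection] {C : H →L[ℂ] K} (hC : ∀ x ∈ p, C x ∈ q)
    (hC' : ∀ y ∈ q, ContinuousLinearMap.adjoint C y ∈ p) (x : H) :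
    C (p.starProjection x) = q.starProjection (C x) := by
  refine (Submodule.eq_starProjection_of_mem_orthogonal
    (hC _ (Submodule.starProjection_apply_mem p x)) ?_).symm
  rw [← map_sub, Submodule.mem_orthogonal]
  intro y hy
  rw [← ContinuousLinearMap.adjoint_inner_left]
  exact Submodule.sub_starProjection_mem_orthogonal x _ (hC' y hy)

theorem apply_eq_self_of_inner_eq {Q : H →L[ℂ] H} (hQ : IsStarProjection Q) {x : H}
    (hx : ⟪x, Q x⟫_ℂ = ⟪x, x⟫_ℂ) : Q x = x := by
  have hQx : ⟪Q x, x⟫_ℂ = ⟪x, x⟫_ℂ := by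
    rw [← ContinuousLinearMap.adjoint_inner_right, ← ContinuousLinearMap.star_eq_adjoint,
      hQ.isSelfAdjoint.star_eq, hx]
  have hQQ : ⟪Q x, Q x⟫_ℂ = ⟪x, x⟫_ℂ := by
    rw [← ContinuousLinearMap.adjoint_inner_right, ← ContinuousLinearMap.star_eq_adjoint,
      hQ.isSelfAdjoint.star_eq, ← mul_apply_eq_comp, hQ.isIdempotentElem.eq, hx]
  rw [← sub_eq_zero, ← inner_self_eq_zero (𝕜 := ℂ), inner_sub_sub_self, hQQ, hQx, hx]
  ring

variable (σ : A →⋆ₐ[ℂ] (L →L[ℂ] L))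

/-- The closed span of the ranges of the intertwiners from `σ` to `π`. -/
def intertwinedPart (π : A →⋆ₐ[ℂ] (H →L[ℂ] H)) : Submodule ℂ H :=
  (⨆ B ∈ {B : L →L[ℂ] H | IsIntertwiner σ π B}, B.range).topologicalClosure

instance (π : A →⋆ₐ[ℂ] (H →L[ℂ] H)) : CompleteSpace (intertwinedPart σ π) :=
  (Submodule.isClosed_topologicalClosure _).completeSpace_coe

variable {σ}

theorem IsIntertwiner.apply_mem_intertwinedPart {π : A →⋆ₐ[ℂ] (H →L[ℂ] H)} {B : L →L[ℂ] H}
    (hB : IsIntertwiner σ π B) (y : L) : B y ∈ intertwinedPart σ π :=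
  Submodule.le_topologicalClosure _ (Submodule.mem_iSup_of_mem B
    (Submodule.mem_iSup_of_mem hB (LinearMap.mem_range_self _ y)))

theorem map_mem_of_mem_intertwinedPart {E : Type*} [NormedAddCommGroup E] [NormedSpace ℂ E]
    {π : A →⋆ₐ[ℂ] (H →L[ℂ] H)} {C : H →L[ℂ] E} {q : Submodule ℂ E} (hq : IsClosed (q : Set E))
    (hC : ∀ B : L →L[ℂ] H, IsIntertwiner σ π B → ∀ y, C (B y) ∈ q) {x : H}
    (hx : x ∈ intertwinedPart σ π) : C x ∈ q := by
  have hle : intertwinedPart σ π ≤ q.comap (C : H →ₗ[ℂ] E) := by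
    refine Submodule.topologicalClosure_minimal _ (iSup₂_le fun B hB => ?_)
      (hq.preimage C.continuous)
    rintro _ ⟨y, rfl⟩
    exact hC B hB y
  exact hle hx

theorem IsIntertwiner.map_mem_intertwinedPart {π : A →⋆ₐ[ℂ] (H →L[ℂ] H)}
    {ρ : A →⋆ₐ[ℂ] (K →L[ℂ] K)} {C : H →L[ℂ] K} (hC : IsIntertwiner π ρ C) :
    ∀ x ∈ intertwinedPart σ π, C x ∈ intertwinedPart σ ρ := fun _ =>
  map_mem_of_mem_intertwinedPart (Submodule.isClosed_topologicalClosure _) fun _ hB y =>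
    (hC.comp hB).apply_mem_intertwinedPart y

theorem bidualRep_mem_intertwinedPart (π : A →⋆ₐ[ℂ] (H →L[ℂ] H)) (F : Bidual A) :
    ∀ x ∈ intertwinedPart σ π, bidualRep π F x ∈ intertwinedPart σ π := fun _ =>
  map_mem_of_mem_intertwinedPart (Submodule.isClosed_topologicalClosure _) fun B hB y => by
    rw [← hB.bidualRep]
    exact hB.apply_mem_intertwinedPart _

theorem bidualRep_apply_eq_self_of_mem_intertwinedPart {F : Bidual A} (hF : bidualRep σ F = 1)
    {π : A →⋆ₐ[ℂ] (H →L[ℂ] H)} {x : H} (hx : x ∈ intertwinedPart σ π) : bidualRep π F x = x := by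
  have hmem : (bidualRep π F - 1) x ∈ (⊥ : Submodule ℂ H) :=
    map_mem_of_mem_intertwinedPart isClosed_singleton (fun B hB y => by
      rw [Submodule.mem_bot, sub_apply, one_apply_eq_self, ← hB.bidualRep, hF, one_apply_eq_self,
        sub_self]) hx
  exact sub_eq_zero.mp hmem

variable [PartialOrder A] [StarOrderedRing A]

theorem isNaturalFamily_starProjection_intertwinedPart (σ : A →⋆ₐ[ℂ] (L →L[ℂ] L)) :
    IsNaturalFamily fun g => (intertwinedPart σ g.gnsStarAlgHom).starProjection :=
  fun _ _ _ hC => map_starProjection hC.map_mem_intertwinedPart hC.adjoint.map_mem_intertwinedPart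

theorem exists_bidualRep_eq_starProjection_intertwinedPart (σ : A →⋆ₐ[ℂ] (L →L[ℂ] L)) :
    ∃ F : Bidual A, ∀ g : A →ₚ[ℂ] ℂ,
      bidualRep g.gnsStarAlgHom F = (intertwinedPart σ g.gnsStarAlgHom).starProjection :=
  (isNaturalFamily_starProjection_intertwinedPart σ).exists_bidualRep_eq
    fun _ => Submodule.starProjection_norm_le _

variable (σ)

/-- The central cover of the representation `σ`: the projection of the bidual that acts in each
GNS representation as the projection onto the part generated by the images of `σ`. -/
def centralCover : Bidual A :=
  (exists_bidualRep_eq_starProjection_intertwinedPart σ).choose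

theorem bidualRep_centralCover (g : A →ₚ[ℂ] ℂ) :
    bidualRep g.gnsStarAlgHom (centralCover σ) =
      (intertwinedPart σ g.gnsStarAlgHom).starProjection :=
  (exists_bidualRep_eq_starProjection_intertwinedPart σ).choose_spec g

theorem isStarProjection_centralCover : IsStarProjection (centralCover σ) where
  isIdempotentElem := Bidual.ext_gns fun g => by
    rw [bidualRep_mul, bidualRep_centralCover]
    exact Submodule.isIdempotentElem_starProjection _
  isSelfAdjoint := Bidual.ext_gns fun g => by
    rw [bidualRep_star, bidualRep_centralCover]
    exact isSelfAdjoint_starProjection _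

theorem centralCover_mul_comm (F : Bidual A) : centralCover σ * F = F * centralCover σ :=
  Bidual.ext_gns fun g => by
    rw [bidualRep_mul, bidualRep_mul, bidualRep_centralCover]
    ext x
    refine (map_starProjection (bidualRep_mem_intertwinedPart _ F) ?_ x).symm
    rw [← ContinuousLinearMap.star_eq_adjoint, ← bidualRep_star]
    exact bidualRep_mem_intertwinedPart _ (star F)

variable {σ}

theorem mul_centralCover_of_bidualRep_eq_one {F : Bidual A} (hF : bidualRep σ F = 1) :
    F * centralCover σ = centralCover σ :=
  Bidual.ext_gns fun g => by
    rw [bidualRep_mul, bidualRep_centralCover]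
    ext x
    rw [mul_apply_eq_comp]
    exact bidualRep_apply_eq_self_of_mem_intertwinedPart hF
      (Submodule.starProjection_apply_mem _ x)

theorem centralCover_apply_ofPositive (ω : A →ₚ[ℂ] ℂ) :
    centralCover ω.gnsStarAlgHom (Bidual.ofPositive ω) = ω 1 := by
  have hξ : gnsVector ω ∈ intertwinedPart ω.gnsStarAlgHom ω.gnsStarAlgHom :=
    IsIntertwiner.apply_mem_intertwinedPart (B := 1) (fun _ _ => rfl) _
  rw [Bidual.apply_ofPositive, bidualRep_centralCover,
    Submodule.starProjection_eq_self_iff.mpr hξ, ← norm_gnsVector_sq]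
  exact inner_self_eq_norm_sq_to_K _

theorem bidualRep_eq_one_of_isSeparatingVector {ω : A →ₚ[ℂ] ℂ}
    (hsep : IsSeparatingVector (gnsBicommutant ω) (gnsVector ω)) {q : Bidual A}
    (hq : IsStarProjection q) (hqω : q (Bidual.ofPositive ω) = ω 1) :
    bidualRep ω.gnsStarAlgHom q = 1 := by
  have hqξ : bidualRep ω.gnsStarAlgHom q (gnsVector ω) = gnsVector ω := by
    refine apply_eq_self_of_inner_eq (isStarProjection_bidualRep _ hq) ?_
    rw [← Bidual.apply_ofPositive, hqω, ← norm_gnsVector_sq]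
    exact (inner_self_eq_norm_sq_to_K (gnsVector ω)).symm
  refine sub_eq_zero.mp (hsep _ ?_ (by rw [sub_apply, hqξ, one_apply_eq_self, sub_self]))
  rw [sub_eq_add_neg]
  exact Set.add_mem_centralizer (bidualRep_mem_bicommutant _ q)
    (Set.neg_mem_centralizer Set.one_mem_centralizer)

theorem isSupport_centralCover {ω : A →ₚ[ℂ] ℂ}
    (hsep : IsSeparatingVector (gnsBicommutant ω) (gnsVector ω)) :
    Bidual.IsSupport ω (centralCover ω.gnsStarAlgHom) := by
  refine ⟨isStarProjection_centralCover _, centralCover_apply_ofPositive ω, fun q hq hqω => ?_⟩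
  have hle := mul_centralCover_of_bidualRep_eq_one
    (bidualRep_eq_one_of_isSeparatingVector hsep hq hqω)
  exact ⟨(centralCover_mul_comm _ q).trans hle, hle⟩

end CentralCover

/-! ### Analysis on the circle -/

/-- The character `z ↦ z ^ m` of the circle. -/
def circleMonomial (m : ℤ) : C(Circle, ℂ) where
  toFun z := (z : ℂ) ^ m
  continuous_toFun := Continuous.zpow₀ (by fun_prop) m fun z => .inl z.coe_ne_zero

/-- The trigonometric polynomial `z ↦ ∑ m, c m * z ^ m`. -/
def trigPoly : (ℤ →₀ ℂ) →ₗ[ℂ] C(Circle, ℂ) :=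
  Finsupp.linearCombination ℂ circleMonomial

theorem denseRange_trigPoly : DenseRange trigPoly := by
  let e : C(Circle, AddCircle (1 : ℝ)) := (AddCircle.homeomorphCircle one_ne_zero).symm
  let Φ := ContinuousMap.compRightAlgHom ℂ ℂ e
  have hΦ : Function.Surjective Φ := fun f =>
    ⟨f.comp (AddCircle.homeomorphCircle one_ne_zero : C(AddCircle (1 : ℝ), Circle)), by
      ext z
      simp [Φ, e]⟩
  have hfourier : DenseRange (Finsupp.linearCombination ℂ (fourier (T := (1 : ℝ)))) := by
    rw [DenseRange, ← LinearMap.coe_range, Finsupp.range_linearCombination,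
      Submodule.dense_iff_topologicalClosure_eq_top]
    exact span_fourier_closure_eq_top
  have hmonomial : circleMonomial = Φ.toLinearMap ∘ fourier := by
    ext m z
    have he : AddCircle.toCircle (e z) = z := by
      rw [← AddCircle.homeomorphCircle_apply one_ne_zero]
      exact Homeomorph.apply_symm_apply _ z
    change (z : ℂ) ^ m = AddCircle.toCircle (m • e z)
    rw [AddCircle.toCircle_zsmul, Circle.coe_zpow, he]
  rw [trigPoly, hmonomial, Finsupp.linearCombination_linear_comp]
  exact hΦ.denseRange.comp hfourier (ContinuousMap.compRightAlgHom_continuous ℂ ℂ e)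

theorem denseRange_toLp_trigPoly (μ : MeasureTheory.Measure Circle)
    [MeasureTheory.IsFiniteMeasure μ] :
    DenseRange fun c => ContinuousMap.toLp (E := ℂ) 2 μ ℂ (trigPoly c) :=
  (ContinuousMap.toLp_denseRange ℂ μ ℂ (by simp)).comp denseRange_trigPoly
    (ContinuousMap.toLp 2 μ ℂ).continuous

theorem circleRotation_zpow (α : ℝ) (k : ℤ) :
    circleRotation α ^ k = Homeomorph.mulLeft (Circle.exp (2 * Real.pi * α * k)) := by
  let mulLeftHom : Circle →* (Circle ≃ₜ Circle) :=
    MonoidHom.mk' Homeomorph.mulLeft fun z w => Homeomorph.ext (mul_assoc z w)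
  have hexp : Circle.exp (2 * Real.pi * α) ^ k = Circle.exp (2 * Real.pi * α * k) := by
    rw [← Circle.exp_intCast_mul, mul_comm]
  rw [← hexp]
  exact (map_zpow mulLeftHom _ k).symm

theorem comap_circleRotation_zpow (μ : MeasureTheory.Measure Circle) (α : ℝ) (k : ℤ) :
    μ.comap (circleRotation α ^ k : Circle ≃ₜ Circle) =
      μ.map (Circle.exp (2 * Real.pi * α * (-k : ℤ)) * ·) := by
  have hsymm : (circleRotation α ^ (-k)).symm = circleRotation α ^ k := by
    rw [zpow_neg]
    rfl
  rw [← hsymm, ← Homeomorph.coe_mulLeft, ← circleRotation_zpow]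
  exact (circleRotation α ^ (-k)).symm.toMeasurableEquiv.map_symm.symm

section Density

variable {X : Type*} [MeasurableSpace X]

theorem continuous_integral_norm_sq_smul {μ : MeasureTheory.Measure X} {G : X → ℂ}
    (hG : MeasureTheory.MemLp G ⊤ μ) :
    Continuous fun u : MeasureTheory.Lp ℂ 2 μ => ∫ x, ‖u x‖ ^ 2 • G x ∂μ := by
  let B : MeasureTheory.Lp ℂ 2 μ →L[ℂ] MeasureTheory.Lp ℂ 2 μ :=
    (ContinuousLinearMap.mul ℂ ℂ).holderL μ ⊤ 2 2 hG.toLp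
  have hB (u : MeasureTheory.Lp ℂ 2 μ) : ⟪u, B u⟫_ℂ = ∫ x, ‖u x‖ ^ 2 • G x ∂μ := by
    rw [MeasureTheory.L2.inner_def]
    refine MeasureTheory.integral_congr_ae ?_
    filter_upwards [(ContinuousLinearMap.mul ℂ ℂ).coeFn_holder hG.toLp u (r := 2), hG.coeFn_toLp]
      with x hx hGx
    have hBx : B u x = G x * u x := by
      rw [← hGx]
      exact hx
    rw [hBx, RCLike.inner_apply, mul_assoc, RCLike.mul_conj, mul_comm, Complex.real_smul]
    norm_cast
  simp only [← hB]
  exact continuous_id.inner B.continuous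

theorem exists_Lp_norm_sq_smul_integral_eq {E : Type*} [NormedAddCommGroup E] [NormedSpace ℝ E]
    {μ ν : MeasureTheory.Measure X} [MeasureTheory.IsFiniteMeasure ν]
    [MeasureTheory.SigmaFinite μ] (hν : ν.AbsolutelyContinuous μ) :
    ∃ s : MeasureTheory.Lp ℂ 2 μ, ∀ G : X → E, ∫ x, ‖s x‖ ^ 2 • G x ∂μ = ∫ x, G x ∂ν := by
  let r : X → ℂ := fun x => (√(ν.rnDeriv μ x).toReal : ℝ)
  have hr (x : X) : ‖r x‖ ^ 2 = (ν.rnDeriv μ x).toReal := by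
    rw [Complex.norm_real, Real.norm_of_nonneg (Real.sqrt_nonneg _),
      Real.sq_sqrt ENNReal.toReal_nonneg]
  have hr_meas : Measurable r := by fun_prop
  have hr_mem : MeasureTheory.MemLp r 2 μ := by
    rw [MeasureTheory.memLp_two_iff_integrable_sq_norm hr_meas.aestronglyMeasurable]
    simp only [hr]
    exact MeasureTheory.Measure.integrable_toReal_rnDeriv
  refine ⟨hr_mem.toLp, fun G => ?_⟩
  rw [← MeasureTheory.integral_rnDeriv_smul hν]
  refine MeasureTheory.integral_congr_ae ?_
  filter_upwards [hr_mem.coeFn_toLp] with x hx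
  rw [hx, hr]

end Density

/-! ### The fibre representations -/

namespace NCTorus

variable (α : ℝ)

theorem ext_weyl {E : Type*} [NormedAddCommGroup E] [NormedSpace ℂ E]
    {f g : NCTorus α →L[ℂ] E} (h : ∀ a, f (weyl α a) = g (weyl α a)) : f = g :=
  ContinuousLinearMap.ext_on (dense_iff_closure_eq.mpr (closure_span_weyl α))
    (Set.eqOn_range.mpr (funext h))

/-- The representation of the noncommutative torus on `ℓ²(ℤ)` attached to a point of the
circle, whose vector state at the basis vector `δ₀` is `fiberState`. -/
def fiberRep (z : Circle) : NCTorus α →⋆ₐ[ℂ] (Ell2 →L[ℂ] Ell2) := eval α (fiberPair α z)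

/-- The basis vector `δ_n` of `ℓ²(ℤ)`. -/
def basisVec (n : ℤ) : Ell2 := lp.single 2 n 1

theorem fiberState_eq_matrixCoeff (z : Circle) (a : NCTorus α) :
    fiberState α z a = matrixCoeff (fiberRep α z) (basisVec 0) (basisVec 0) a := rfl

theorem fiberState_one (z : Circle) : fiberState α z 1 = 1 := by
  rw [fiberState_eq_matrixCoeff, matrixCoeff_apply, map_one, one_apply_eq_self, basisVec,
    lp.inner_single_left, lp.single_apply_self]
  simp

theorem fiberRep_weyl_apply (z : Circle) (m n : ℤ) (g : Ell2) (j : ℤ) :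
    fiberRep α z (weyl α (m, n)) g j =
      ((Circle.exp (-(2 * Real.pi * α * m * n)) *
        (Circle.exp (4 * Real.pi * α * j) * z) ^ m : Circle) : ℂ) * g (j - n) := by
  have hUV : fiberRep α z ((U α ^ m * V α ^ n : unitary (NCTorus α)) : NCTorus α) =
      ((diagHom (fun n => Circle.exp (4 * Real.pi * α * n) * z) ^ m *
        shiftHom (Multiplicative.ofAdd 1) ^ n : unitary (Ell2 →L[ℂ] Ell2)) :
          Ell2 →L[ℂ] Ell2) := by
    change ((Unitary.map (evalMon α (fiberPair α z)) (U α ^ m * V α ^ n) :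
      unitary (fiberPair α z).carrier) : (fiberPair α z).carrier) = _
    rw [map_mul, map_zpow, map_zpow]
    rfl
  have hexp : Complex.exp (-(2 * Real.pi * Complex.I * α * m * n)) =
      Circle.exp (-(2 * Real.pi * α * m * n)) := by
    rw [Circle.coe_exp]
    congr 1
    push_cast
    ring
  rw [weyl, map_smul, hUV, ← map_zpow, ← map_zpow, ← ofAdd_zsmul, hexp, Circle.coe_mul, mul_assoc]
  change (_ : ℂ) * ((_ : Ell2 →L[ℂ] Ell2) _ : Ell2) j = _
  rw [Submonoid.coe_mul, mul_apply_eq_comp]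
  simp [diagHom, shiftHom, twist_apply, mul_assoc]

theorem fiberRep_weyl_basisVec (z : Circle) (m n : ℤ) :
    fiberRep α z (weyl α (m, n)) (basisVec 0) =
      ((Circle.exp (2 * Real.pi * α * m * n) * z ^ m : Circle) : ℂ) • basisVec n := by
  apply lp.ext
  funext j
  rw [fiberRep_weyl_apply, lp.coeFn_smul, Pi.smul_apply, smul_eq_mul]
  rcases eq_or_ne j n with rfl | hj
  · rw [mul_zpow, ← mul_assoc, ← Circle.exp_intCast_mul, ← Circle.exp_add, basisVec, basisVec,
      sub_self, lp.single_apply_self, lp.single_apply_self]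
    congr 4
    ring
  · rw [basisVec, basisVec, lp.single_apply_ne _ _ _ (sub_ne_zero.mpr hj),
      lp.single_apply_ne _ _ _ hj, mul_zero, mul_zero]

theorem matrixCoeff_basisVec (z : Circle) (n : ℤ) (a : NCTorus α) :
    matrixCoeff (fiberRep α z) (basisVec n) (basisVec n) a =
      fiberState α (Circle.exp (4 * Real.pi * α * n) * z) a := by
  rw [fiberState_eq_matrixCoeff]
  refine DFunLike.congr_fun (ext_weyl α ?_) a
  rintro ⟨m, k⟩
  rw [matrixCoeff_apply, matrixCoeff_apply, basisVec, basisVec, lp.inner_single_left,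
    lp.inner_single_left, fiberRep_weyl_apply, fiberRep_weyl_apply]
  rcases eq_or_ne k 0 with rfl | hk
  · simp
  · simp [hk]

theorem fiberState_weyl_conj (z : Circle) (m n : ℤ) (a : NCTorus α) :
    fiberState α z (star (weyl α (m, n)) * a * weyl α (m, n)) =
      fiberState α (Circle.exp (4 * Real.pi * α * n) * z) a := by
  rw [fiberState_eq_matrixCoeff, ← matrixCoeff_map_map, fiberRep_weyl_basisVec,
    matrixCoeff_smul_smul, Circle.norm_coe, one_pow, one_smul, matrixCoeff_basisVec]

/-- The element `∑ m, c m • U ^ m`, which acts on the basis vector `δ₀` of the fibre over `z` as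
the value at `z` of the trigonometric polynomial with coefficients `c`. -/
def trigElem : (ℤ →₀ ℂ) →ₗ[ℂ] NCTorus α :=
  Finsupp.linearCombination ℂ fun m => weyl α (m, 0)

theorem fiberRep_trigElem (z : Circle) (c : ℤ →₀ ℂ) :
    fiberRep α z (trigElem α c) (basisVec 0) = trigPoly c z • basisVec 0 := by
  induction c using Finsupp.induction_linear with
  | zero => simp only [map_zero, zero_apply, ContinuousMap.zero_apply, zero_smul]
  | add f g hf hg => simp only [map_add, add_apply, ContinuousMap.add_apply, add_smul, hf, hg]
  | single m r =>
    rw [trigElem, trigPoly, Finsupp.linearCombination_single, Finsupp.linearCombination_single,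
      map_smul, smul_apply, fiberRep_weyl_basisVec, ContinuousMap.smul_apply, smul_assoc]
    simp [circleMonomial]

theorem fiberState_trigElem_conj (z : Circle) (c : ℤ →₀ ℂ) (a : NCTorus α) :
    fiberState α z (star (trigElem α c) * a * trigElem α c) =
      ‖trigPoly c z‖ ^ 2 • fiberState α z a := by
  rw [fiberState_eq_matrixCoeff, ← matrixCoeff_map_map, fiberRep_trigElem,
    matrixCoeff_smul_smul, ← fiberState_eq_matrixCoeff]

/-! ### The state as an integral of fibre states -/

variable (μ : MeasureTheory.Measure Circle)

theorem memLp_top_fiberState (a : NCTorus α) :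
    MeasureTheory.MemLp (fun z => fiberState α z a) ⊤ μ :=
  MeasureTheory.memLp_top_of_bound (continuous_fiberState α a).aestronglyMeasurable ‖a‖
    (.of_forall fun z => norm_fiberState_le α z a)

theorem integrable_fiberState [MeasureTheory.IsFiniteMeasure μ] (a : NCTorus α) :
    MeasureTheory.Integrable (fun z => fiberState α z a) μ :=
  (memLp_top_fiberState α μ a).integrable le_top

variable [MeasureTheory.IsProbabilityMeasure μ]

theorem state_weyl (m n : ℤ) :
    state α μ (weyl α (m, n)) = if n = 0 then fourierAnti μ m else 0 := by
  have h : weylSum α (Finsupp.single (m, n) 1) = weyl α (m, n) := by simp [weylSum]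
  rw [← h, state_weylSum, finsum_eq_single _ m fun k hk => by simp [hk.symm]]
  rcases eq_or_ne n 0 with rfl | hn
  · simp
  · simp [hn]

theorem state_eq_integral (a : NCTorus α) : state α μ a = ∫ z, fiberState α z a ∂μ := by
  let I : NCTorus α →L[ℂ] ℂ := LinearMap.mkContinuous
    { toFun := fun a => ∫ z, fiberState α z a ∂μ
      map_add' := fun a b => by
        simp only [fiberState_add]
        exact MeasureTheory.integral_add (integrable_fiberState α μ a) (integrable_fiberState α μ b)
      map_smul' := fun r a => by
        simp only [fiberState_smul]
        exact MeasureTheory.integral_const_mul _ _ } 1 fun a => by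
      refine (MeasureTheory.norm_integral_le_of_norm_le_const
        (.of_forall fun z => norm_fiberState_le α z a)).trans_eq ?_
      rw [MeasureTheory.probReal_univ, mul_one, one_mul]
  refine DFunLike.congr_fun (f := Bidual.ofPositive (state α μ)) (g := I) (ext_weyl α ?_) a
  rintro ⟨m, n⟩
  change state α μ (weyl α (m, n)) = ∫ z, fiberState α z (weyl α (m, n)) ∂μ
  simp only [state_weyl, fiberState_weyl]
  split_ifs
  · rfl
  · exact (MeasureTheory.integral_zero _ _).symm

theorem state_weyl_conj (m n : ℤ) (a : NCTorus α) :
    state α μ (star (weyl α (m, n)) * a * weyl α (m, n)) =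
      ∫ z, fiberState α (Circle.exp (4 * Real.pi * α * n) * z) a ∂μ := by
  simp only [state_eq_integral, fiberState_weyl_conj]

theorem state_trigElem_conj (c : ℤ →₀ ℂ) (a : NCTorus α) :
    state α μ (star (trigElem α c) * a * trigElem α c) =
      ∫ z, ‖trigPoly c z‖ ^ 2 • fiberState α z a ∂μ := by
  simp only [state_eq_integral, fiberState_trigElem_conj]

/-! ### The cyclic vector is separating -/

/-- The vector `∑ m, c m • π(U ^ m) ξ` of the GNS space of `state α μ`. -/
def trigVec : (ℤ →₀ ℂ) →ₗ[ℂ] (state α μ).GNS :=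
  (orbitMap (state α μ).gnsStarAlgHom (gnsVector (state α μ))).toLinearMap ∘ₗ trigElem α

theorem norm_gnsStarAlgHom_trigVec_sq (a : NCTorus α) (c : ℤ →₀ ℂ) :
    (‖(state α μ).gnsStarAlgHom a (trigVec α μ c)‖ : ℂ) ^ 2 =
      ∫ z, ‖trigPoly c z‖ ^ 2 • fiberState α z (star a * a) ∂μ :=
  (norm_gnsStarAlgHom_gnsStarAlgHom_gnsVector_sq _ a (trigElem α c)).trans
    (state_trigElem_conj α μ c _)

theorem norm_trigVec (c : ℤ →₀ ℂ) :
    ‖trigVec α μ c‖ = ‖ContinuousMap.toLp (E := ℂ) 2 μ ℂ (trigPoly c)‖ := by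
  have h := norm_gnsStarAlgHom_trigVec_sq α μ 1 c
  simp only [map_one, one_apply_eq_self, star_one, mul_one, fiberState_one] at h
  rw [← sq_eq_sq₀ (norm_nonneg _) (norm_nonneg _), ← Complex.ofReal_inj, Complex.ofReal_pow, h,
    Complex.ofReal_pow, ← RCLike.ofReal_eq_complex_ofReal, ← inner_self_eq_norm_sq_to_K,
    MeasureTheory.ContinuousMap.inner_toLp]
  refine MeasureTheory.integral_congr_ae (.of_forall fun z => ?_)
  simp [RCLike.mul_conj]

/-- The isometric embedding of `L²(μ)` in the GNS space of `state α μ` which maps the class of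
`z ^ m` to `π(U ^ m) ξ`. It is the extension of `trigVec` by continuity. -/
def lpEmbedding : MeasureTheory.Lp ℂ 2 μ →L[ℂ] (state α μ).GNS :=
  (trigVec α μ).extendOfNorm ((ContinuousMap.toLp (E := ℂ) 2 μ ℂ).toLinearMap ∘ₗ trigPoly)

theorem lpEmbedding_toLp_trigPoly (c : ℤ →₀ ℂ) :
    lpEmbedding α μ (ContinuousMap.toLp 2 μ ℂ (trigPoly c)) = trigVec α μ c :=
  LinearMap.extendOfNorm_eq (denseRange_toLp_trigPoly μ)
    ⟨1, fun c => (norm_trigVec α μ c).trans_le (one_mul _).ge⟩ c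

theorem norm_gnsStarAlgHom_lpEmbedding_sq (a : NCTorus α) (s : MeasureTheory.Lp ℂ 2 μ) :
    (‖(state α μ).gnsStarAlgHom a (lpEmbedding α μ s)‖ : ℂ) ^ 2 =
      ∫ z, ‖s z‖ ^ 2 • fiberState α z (star a * a) ∂μ := by
  have hcont : Continuous fun s =>
      (‖(state α μ).gnsStarAlgHom a (lpEmbedding α μ s)‖ : ℂ) ^ 2 := by fun_prop
  refine congrFun ((denseRange_toLp_trigPoly μ).equalizer hcont
    (continuous_integral_norm_sq_smul (memLp_top_fiberState α μ (star a * a)))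
    (funext fun c => ?_)) s
  simp only [Function.comp_apply, lpEmbedding_toLp_trigPoly, norm_gnsStarAlgHom_trigVec_sq]
  refine MeasureTheory.integral_congr_ae ?_
  filter_upwards [ContinuousMap.coeFn_toLp (p := 2) μ (𝕜 := ℂ) (trigPoly c)] with z hz
  rw [hz]

theorem norm_gnsStarAlgHom_weyl_sq (a : NCTorus α) (m n : ℤ) :
    (‖(state α μ).gnsStarAlgHom a
        ((state α μ).gnsStarAlgHom (weyl α (m, n)) (gnsVector (state α μ)))‖ : ℂ) ^ 2 =
      ∫ z, fiberState α (Circle.exp (4 * Real.pi * α * n) * z) (star a * a) ∂μ := by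
  rw [norm_gnsStarAlgHom_gnsStarAlgHom_gnsVector_sq, state_weyl_conj]

variable {α μ}

theorem comp_lpEmbedding_eq_zero {T : (state α μ).GNS →L[ℂ] (state α μ).GNS}
    (hT : T ∈ gnsBicommutant (state α μ)) (hξ : T (gnsVector (state α μ)) = 0) :
    T ∘L lpEmbedding α μ = 0 := by
  have hmonomial (m : ℤ) :
      T ((state α μ).gnsStarAlgHom (weyl α (m, 0)) (gnsVector (state α μ))) = 0 := by
    refine apply_eq_zero_of_norm_le (fun a => le_of_eq ?_) hT hξ
    rw [← sq_eq_sq₀ (norm_nonneg _) (norm_nonneg _), ← Complex.ofReal_inj, Complex.ofReal_pow,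
      Complex.ofReal_pow, norm_gnsStarAlgHom_weyl_sq, norm_gnsStarAlgHom_gnsVector_sq,
      state_eq_integral]
    simp
  have htrig : T.toLinearMap ∘ₗ trigVec α μ = 0 := by
    refine Finsupp.lhom_ext' fun m => LinearMap.ext_ring ?_
    simpa only [trigVec, trigElem, LinearMap.comp_apply, Finsupp.lsingle_apply,
      Finsupp.linearCombination_single, one_smul, ContinuousLinearMap.coe_coe, orbitMap_apply,
      LinearMap.zero_apply] using hmonomial m
  refine ContinuousLinearMap.coeFn_injective ((denseRange_toLp_trigPoly μ).equalizer
    (by fun_prop) (by fun_prop) (funext fun c => ?_))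
  simpa [lpEmbedding_toLp_trigPoly] using DFunLike.congr_fun htrig c

theorem exists_norm_gnsStarAlgHom_lpEmbedding_eq {n : ℤ}
    (hν : (μ.map (Circle.exp (4 * Real.pi * α * n) * ·)).AbsolutelyContinuous μ) (m : ℤ) :
    ∃ s : MeasureTheory.Lp ℂ 2 μ, ∀ a,
      ‖(state α μ).gnsStarAlgHom a
          ((state α μ).gnsStarAlgHom (weyl α (m, n)) (gnsVector (state α μ)))‖ =
        ‖(state α μ).gnsStarAlgHom a (lpEmbedding α μ s)‖ := by
  obtain ⟨s, hs⟩ := exists_Lp_norm_sq_smul_integral_eq (E := ℂ) hν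
  refine ⟨s, fun a => ?_⟩
  rw [← sq_eq_sq₀ (norm_nonneg _) (norm_nonneg _), ← Complex.ofReal_inj, Complex.ofReal_pow,
    Complex.ofReal_pow, norm_gnsStarAlgHom_weyl_sq, norm_gnsStarAlgHom_lpEmbedding_sq, hs,
    (measurableEmbedding_mulLeft _).integral_map]

theorem isSeparatingVector_gnsVector
    (hμ : ∀ n : ℤ,
      (μ.comap (circleRotation α ^ (2 * n) : Circle ≃ₜ Circle)).AbsolutelyContinuous μ) :
    IsSeparatingVector (gnsBicommutant (state α μ)) (gnsVector (state α μ)) := by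
  intro T hT hξ
  have hweyl (m n : ℤ) :
      T ((state α μ).gnsStarAlgHom (weyl α (m, n)) (gnsVector (state α μ))) = 0 := by
    have hangle : 2 * Real.pi * α * (-(2 * -n) : ℤ) = 4 * Real.pi * α * n := by
      push_cast
      ring
    have hν := hμ (-n)
    rw [comap_circleRotation_zpow, hangle] at hν
    obtain ⟨s, hs⟩ := exists_norm_gnsStarAlgHom_lpEmbedding_eq hν m
    exact apply_eq_zero_of_norm_le (fun a => (hs a).le) hT
      (DFunLike.congr_fun (comp_lpEmbedding_eq_zero hT hξ) s)
  have horbit : T ∘L orbitMap (state α μ).gnsStarAlgHom (gnsVector (state α μ)) = 0 :=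
    ext_weyl α fun a => hweyl a.1 a.2
  exact ContinuousLinearMap.coeFn_injective
    ((denseRange_gnsStarAlgHom_gnsVector _).equalizer T.continuous continuous_zero
      (funext (DFunLike.congr_fun horbit)))

end NCTorus

end

theorem mainTheorem8_general (α : ℝ)
    (μ : MeasureTheory.Measure Circle) [MeasureTheory.IsProbabilityMeasure μ]
    (hμ : ∀ n : ℤ,
      (μ.comap (circleRotation α ^ (2 * n) : Circle ≃ₜ Circle)).AbsolutelyContinuous μ) :
    (∃ p : Bidual (NCTorus α), Bidual.IsSupport (NCTorus.state α μ) p ∧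
      ∀ F : Bidual (NCTorus α), p * F = F * p) ∧
    (∀ T ∈ gnsBicommutant (NCTorus.state α μ), T (gnsVector (NCTorus.state α μ)) = 0 → T = 0) := by
  have hsep := NCTorus.isSeparatingVector_gnsVector hμ
  exact ⟨⟨centralCover _, isSupport_centralCover hsep, centralCover_mul_comm _⟩, hsep⟩

theorem mainTheorem8 (α : ℝ) (hα : Irrational α)
    (μ : MeasureTheory.Measure Circle) [MeasureTheory.IsProbabilityMeasure μ]
    (hμ : ∀ n : ℤ, (μ.comap (circleRotation α ^ (2 * n) : Circle ≃ₜ Circle)).AbsolutelyContinuous μ) :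
    (∃ p : Bidual (NCTorus α), Bidual.IsSupport (NCTorus.state α μ) p ∧
      ∀ F : Bidual (NCTorus α), p * F = F * p) ∧
    (∀ T ∈ gnsBicommutant (NCTorus.state α μ), T (gnsVector (NCTorus.state α μ)) = 0 → T = 0) :=
  mainTheorem8_general α μ hμ
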